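/- Let $S$ be a countable inverse semigroup: a semigroup in which every $s$ has a unique $s^*$ with $ss^*s=s$ and $s^*ss^*=s^*$. Write $E(S)$ for its set of idempotents and $s\le t$ for $s=ts^*s$. Let $X$ be a non-empty, second-countable, zero-dimensional (i.e. having a basis of compact-open sets), locally compact Hausdorff space, and let $R$ be a field. Let $\theta=(\{X_s\}_{s\in S},\{\theta_s\}_{s\in S})$ be a topological partial action of $S$ on $X$, that is, open sets $X_s\subseteq X$ and homeomorphisms $\theta_s:X_{s^*}\to X_s$ such that $X=\bigcup_{e\in E(S)}X_e$ and, for all $s,t\in S$, $\theta_s(X_{s^*}\cap X_t)=X_s\cap X_{st}$ and $\theta_s(\theta_t(x))=\theta_{st}(x)$ for all $x\in X_{t^*}\cap X_{t^*s^*}$. Let $\mathcal L_c(X)$ be the ring of locally constant, compactly supported functions $f:X\to R$, where $\operatorname{supp}(f)=\{x\in X: f(x)\ne 0\}$. Put $D_s=\{f\in\mathcal L_c(X):\operatorname{supp}(f)\subseteq X_s\}$ and let $\alpha_s:D_{s^*}\to D_s$ be the ring isomorphism for which $\alpha_s(f)$ equals $f\circ\theta_{s^*}$ on $X_s$ and $0$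 off $X_s$. Let $\mathcal L$ be the ring of finite formal sums $\sum_{s\in S}a_s\delta_s$ with $a_s\in D_s$, with componentwise addition and the biadditive multiplication given by $(a\delta_s)(b\delta_t)=\alpha_s(\alpha_{s^*}(a)b)\delta_{st}$. Let $\mathcal N$ be the two-sided ideal of $\mathcal L$ generated by all $a\delta_r-a\delta_s$ with $r\le s$ and $a\in D_r$, and let $\mathcal L_c(X)\rtimes_\alpha S=\mathcal L/\mathcal N$ be the skew inverse semigroup ring. The map $\sum_s a_s\delta_s\mapsto\sum_s a_s$ vanishes on $\mathcal N$ and so induces an additive map $\widetilde\tau:\mathcal L_c(X)\rtimes_\alpha S\to\mathcal L_c(X)$. Then $\mathcal L_c(X)\rtimes_\alpha S$ is simple (non-zero, with no two-sided ideals other than $0$ and itself) if and only if the following three conditions all hold: 1. $\theta$ is minimal: there is no non-empty, proper, open subset $U\subset X$ with $\theta_s(U\cap X_{s^*})\subseteq U$ for all $s\in S$. 2. $\theta$ is topologically principal: the set of all $x\in X$ such that, for every $s\in S$ with $x\in X_{s^*}$ and $\theta_s(x)=x$, there is $e\in E(S)$ with $e\le s$ and $x\in X_e$, is dense in $X$.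 3. For every non-zero two-sided ideal $\mathcal I$ of $\mathcal L_c(X)\rtimes_\alpha S$ there is some $f\in\mathcal I$ with $\operatorname{supp}(\widetilde\tau(f))\neq\varnothing$. -/

import Mathlib

open Function

/-! ### Inverse semigroups -/

/-- An inverse semigroup: every `s` has exactly one element `s⁻¹` (written `s^*` in the literature)
with `s s⁻¹ s = s` and `s⁻¹ s s⁻¹ = s⁻¹`. -/
class InverseSemigroup (S : Type*) extends Semigroup S, Inv S where
  mul_inv_mul (s : S) : s * s⁻¹ * s = s
  inv_mul_inv (s : S) : s⁻¹ * s * s⁻¹ = s⁻¹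
  inv_unique (s t : S) : s * t * s = s → t * s * t = t → t = s⁻¹

namespace InverseSemigroup

variable {S : Type*} [InverseSemigroup S]

/-- The natural partial order: `s ≤ t` iff `s = t s⁻¹ s`. -/
def NatLE (s t : S) : Prop := s = t * (s⁻¹ * s)

theorem invInv (s : S) : s⁻¹⁻¹ = s :=
  (inv_unique s⁻¹ s (inv_mul_inv s) (mul_inv_mul s)).symm

theorem inv_idem {e : S} (he : IsIdempotentElem e) : e⁻¹ = e :=
  (inv_unique e e (by rw [he.eq, he.eq]) (by rw [he.eq, he.eq])).symm

theorem idem_mul_inv (s : S) : IsIdempotentElem (s * s⁻¹) := by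
  rw [IsIdempotentElem, ← mul_assoc, mul_inv_mul]

theorem idem_inv_mul (s : S) : IsIdempotentElem (s⁻¹ * s) := by
  rw [IsIdempotentElem, ← mul_assoc, inv_mul_inv]

theorem idem_mul {e f : S} (he : IsIdempotentElem e) (hf : IsIdempotentElem f) :
    IsIdempotentElem (e * f) := by
  have he' : ∀ z : S, e * (e * z) = e * z := fun z => by rw [← mul_assoc, he.eq]
  have hf' : ∀ z : S, f * (f * z) = f * z := fun z => by rw [← mul_assoc, hf.eq]
  obtain ⟨x, hx⟩ : ∃ x, x = (e * f)⁻¹ := ⟨_, rfl⟩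
  have h1 : e * (f * (x * (e * f))) = e * f := by
    have := mul_inv_mul (e * f)
    rw [← hx] at this
    simpa only [mul_assoc] using this
  have h2 : x * (e * (f * x)) = x := by
    have := inv_mul_inv (e * f)
    rw [← hx] at this
    simpa only [mul_assoc] using this
  have h2' : ∀ z, x * (e * (f * (x * z))) = x * z := fun z => by
    have := congrArg (· * z) h2
    simpa only [mul_assoc] using this
  have h3 : f * (x * e) = x := by
    rw [hx]
    apply inv_unique
    · rw [← hx]; simp only [mul_assoc, he', hf']; exact h1
    · rw [← hx]; simp only [mul_assoc, he', hf', h2']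
  have hxi : IsIdempotentElem x := by
    have : (f * (x * e)) * (f * (x * e)) = f * (x * e) := by
      simp only [mul_assoc, h2']
    rwa [h3] at this
  have : x = e * f := by
    have h := inv_idem hxi
    rw [hx, invInv] at h
    rw [hx]; exact h.symm
  rwa [← this]

theorem idem_comm {e f : S} (he : IsIdempotentElem e) (hf : IsIdempotentElem f) :
    e * f = f * e := by
  have he' : ∀ z : S, e * (e * z) = e * z := fun z => by rw [← mul_assoc, he.eq]
  have hf' : ∀ z : S, f * (f * z) = f * z := fun z => by rw [← mul_assoc, hf.eq]
  have h1 : e * (f * (e * f)) = e * f := by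
    have := (idem_mul he hf).eq
    simpa only [mul_assoc] using this
  have h2 : f * (e * (f * e)) = f * e := by
    have := (idem_mul hf he).eq
    simpa only [mul_assoc] using this
  have h := inv_unique (e * f) (f * e)
    (by simp only [mul_assoc, he', hf']; exact h1) (by simp only [mul_assoc, he', hf']; exact h2)
  rw [h, inv_idem (idem_mul he hf)]

theorem mulInv (s t : S) : (s * t)⁻¹ = t⁻¹ * s⁻¹ := by
  have hc : t * t⁻¹ * (s⁻¹ * s) = s⁻¹ * s * (t * t⁻¹) :=
    idem_comm (idem_mul_inv t) (idem_inv_mul s)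
  symm
  apply inv_unique
  · calc s * t * (t⁻¹ * s⁻¹) * (s * t) = s * (t * t⁻¹ * (s⁻¹ * s)) * t := by
          simp only [mul_assoc]
      _ = (s * s⁻¹ * s) * (t * t⁻¹ * t) := by rw [hc]; simp only [mul_assoc]
      _ = s * t := by rw [mul_inv_mul, mul_inv_mul]
  · calc t⁻¹ * s⁻¹ * (s * t) * (t⁻¹ * s⁻¹) = t⁻¹ * (s⁻¹ * s * (t * t⁻¹)) * s⁻¹ := by
          simp only [mul_assoc]
      _ = (t⁻¹ * t * t⁻¹) * (s⁻¹ * s * s⁻¹) := by rw [← hc]; simp only [mul_assoc]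
      _ = t⁻¹ * s⁻¹ := by rw [inv_mul_inv, inv_mul_inv]

theorem NatLE.mul_left {r s : S} (h : NatLE r s) (t : S) : NatLE (t * r) (t * s) := by
  have hc : r * r⁻¹ * (t⁻¹ * t) = t⁻¹ * t * (r * r⁻¹) :=
    idem_comm (idem_mul_inv r) (idem_inv_mul t)
  unfold NatLE at h ⊢
  rw [mulInv]
  symm
  calc t * s * (r⁻¹ * t⁻¹ * (t * r)) = t * s * ((r⁻¹ * r * r⁻¹) * t⁻¹ * (t * r)) := by
        rw [inv_mul_inv]
    _ = t * ((s * (r⁻¹ * r)) * r⁻¹ * (t⁻¹ * t)) * r := by simp only [mul_assoc]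
    _ = t * (r * r⁻¹ * (t⁻¹ * t)) * r := by rw [← h]
    _ = (t * t⁻¹ * t) * (r * r⁻¹ * r) := by rw [hc]; simp only [mul_assoc]
    _ = t * r := by rw [mul_inv_mul, mul_inv_mul]

theorem NatLE.mul_right {r s : S} (h : NatLE r s) (u : S) : NatLE (r * u) (s * u) := by
  have hc : u * u⁻¹ * (r⁻¹ * r) = r⁻¹ * r * (u * u⁻¹) :=
    idem_comm (idem_mul_inv u) (idem_inv_mul r)
  unfold NatLE at h ⊢
  rw [mulInv]
  symm
  calc s * u * (u⁻¹ * r⁻¹ * (r * u)) = s * (u * u⁻¹ * (r⁻¹ * r)) * u := by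
        simp only [mul_assoc]
    _ = (s * (r⁻¹ * r)) * (u * u⁻¹ * u) := by rw [hc]; simp only [mul_assoc]
    _ = r * u := by rw [← h, mul_inv_mul]

end InverseSemigroup

open InverseSemigroup

/-! ### Partial actions on rings and skew inverse semigroup rings -/

/-- A partial action of an inverse semigroup `S` on an associative ring `A`: ideals `D s` and ring
isomorphisms `π s : D s⁻¹ → D s` such that the `D e` with `e` idempotent generate `A` additively,
`π s (D s⁻¹ ∩ D t) = D s ∩ D (s t)`, and `π s (π t x) = π (s t) x` for `x ∈ D t⁻¹ ∩ D (t⁻¹ s⁻¹)`.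
The hypotheses `h` in the last field only make the two sides type-correct; both always hold. -/
structure RingPartialAction (S : Type*) [InverseSemigroup S] (A : Type*) [NonUnitalRing A] where
  D : S → TwoSidedIdeal A
  π : ∀ s, D s⁻¹ ≃+* D s
  closure_iUnion : AddSubgroup.closure (⋃ e ∈ {e : S | IsIdempotentElem e}, (D e : Set A)) = ⊤
  image_inter : ∀ s t,
    (fun x : D s⁻¹ => (π s x : A)) '' {x | (x : A) ∈ D t} = (D s : Set A) ∩ D (s * t)
  map_map : ∀ (s t : S) (x : A) (hx : x ∈ D t⁻¹), x ∈ D (t⁻¹ * s⁻¹) →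
    ∀ (h : (π t ⟨x, hx⟩ : A) ∈ D s⁻¹) (h' : x ∈ D (s * t)⁻¹),
      (π s ⟨π t ⟨x, hx⟩, h⟩ : A) = π (s * t) ⟨x, h'⟩

namespace RingPartialAction

variable {S : Type*} [InverseSemigroup S] {A : Type*} [NonUnitalRing A]
  (P : RingPartialAction S A)

theorem D_le (s : S) {x : A} (hx : x ∈ P.D s) : x ∈ P.D (s * s⁻¹) := by
  have h := P.image_inter s s⁻¹
  have hx' : x ∈ (fun y : P.D s⁻¹ => (P.π s y : A)) '' {y | (y : A) ∈ P.D s⁻¹} :=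
    ⟨(P.π s).symm ⟨x, hx⟩, ((P.π s).symm ⟨x, hx⟩).2, by simp⟩
  rw [h] at hx'
  exact hx'.2

theorem π_congr {s t : S} (h : s = t) {x : A} (hx : x ∈ P.D s⁻¹) (hx' : x ∈ P.D t⁻¹) :
    (P.π s ⟨x, hx⟩ : A) = P.π t ⟨x, hx'⟩ := by
  subst h; rfl

theorem π_idem {e : S} (he : IsIdempotentElem e) {x : A} (hx : x ∈ P.D e⁻¹) :
    (P.π e ⟨x, hx⟩ : A) = x := by
  have hi : e⁻¹ = e := inv_idem he
  have h1 : (P.π e ⟨x, hx⟩ : A) ∈ P.D e⁻¹ := by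
    have := (P.π e ⟨x, hx⟩).2
    exact (congrArg (fun t => (P.π e ⟨x, hx⟩ : A) ∈ P.D t) hi).mpr this
  have h := P.map_map e e x hx (by rw [hi, he.eq]; rwa [hi] at hx) h1 (by rw [he.eq]; exact hx)
  rw [P.π_congr he.eq _ hx] at h
  have := (P.π e).injective (Subtype.ext h)
  exact congrArg Subtype.val this

theorem D_inter_idem {e : S} (he : IsIdempotentElem e) (t : S) {x : A} (hx : x ∈ P.D e) :
    x ∈ P.D (e * t) ↔ x ∈ P.D t := by
  have hx' : x ∈ P.D e⁻¹ := by rwa [inv_idem he]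
  have h := P.image_inter e t
  constructor
  · intro hxt
    have : x ∈ (P.D e : Set A) ∩ P.D (e * t) := ⟨hx, hxt⟩
    rw [← h] at this
    obtain ⟨y, hy, hyx⟩ := this
    have := P.π_idem he y.2
    rw [← hyx]
    change (P.π e ⟨y, y.2⟩ : A) ∈ P.D t
    rw [this]; exact hy
  · intro hxt
    have : x ∈ (fun y : P.D e⁻¹ => (P.π e y : A)) '' {y | (y : A) ∈ P.D t} :=
      ⟨⟨x, hx'⟩, hxt, P.π_idem he hx'⟩
    rw [h] at this
    exact this.2

theorem D_inv_mono {r s : S} (h : NatLE r s) {x : A} (hx : x ∈ P.D r⁻¹) : x ∈ P.D s⁻¹ := by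
  have hr : x ∈ P.D (r⁻¹ * r) := by
    have := P.D_le r⁻¹ hx
    rwa [invInv] at this
  rw [← P.D_inter_idem (idem_inv_mul r) s⁻¹ hr]
  have : r⁻¹ * r * s⁻¹ = r⁻¹ := by
    have h' : r⁻¹ = (s * (r⁻¹ * r))⁻¹ := congrArg _ h
    rw [mulInv, inv_idem (idem_inv_mul r)] at h'
    exact h'.symm
  rwa [this]

theorem π_restrict {r s : S} (h : NatLE r s) {x : A} (hx : x ∈ P.D r⁻¹) (hx' : x ∈ P.D s⁻¹) :
    (P.π r ⟨x, hx⟩ : A) = P.π s ⟨x, hx'⟩ := by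
  have hi : (r⁻¹ * r)⁻¹ = r⁻¹ * r := inv_idem (idem_inv_mul r)
  have hr : x ∈ P.D (r⁻¹ * r)⁻¹ := by
    have := P.D_le r⁻¹ hx
    rwa [invInv, ← hi] at this
  have he := P.π_idem (idem_inv_mul r) hr
  have hinv : (s * (r⁻¹ * r))⁻¹ = r⁻¹ := congrArg _ (Eq.symm h)
  have hm := P.map_map s (r⁻¹ * r) x hr (by rw [← mulInv, hinv]; exact hx)
    (by rw [he]; exact hx') (by rw [hinv]; exact hx)
  rw [P.π_congr (Eq.symm h) _ hx] at hm
  rw [← hm]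
  congr 2
  exact Subtype.ext he

theorem π_symm_restrict {r s : S} (h : NatLE r s) {a : A} (ha : a ∈ P.D r) (ha' : a ∈ P.D s) :
    ((P.π r).symm ⟨a, ha⟩ : A) = (P.π s).symm ⟨a, ha'⟩ := by
  obtain ⟨y, hy⟩ : ∃ y, y = (P.π r).symm ⟨a, ha⟩ := ⟨_, rfl⟩
  have hys := P.D_inv_mono h y.2
  have h1 : (P.π s ⟨y, hys⟩ : A) = a := by
    rw [← P.π_restrict h y.2 hys, hy]; simp
  have h2 : P.π s ⟨y, hys⟩ = ⟨a, ha'⟩ := Subtype.ext h1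
  rw [← hy, ← h2]; simp

/-- `π s⁻¹` is the inverse of `π s`. -/
theorem π_inv (s : S) {a : A} (ha : a ∈ P.D s) (ha' : a ∈ P.D s⁻¹⁻¹) :
    (P.π s⁻¹ ⟨a, ha'⟩ : A) = (P.π s).symm ⟨a, ha⟩ := by
  have hd : a ∈ P.D (s * s⁻¹)⁻¹ := by
    rw [inv_idem (idem_mul_inv s)]; exact P.D_le s ha
  have hm := P.map_map s s⁻¹ a ha'
    (by rw [invInv]; exact P.D_le s ha) (P.π s⁻¹ ⟨a, ha'⟩).2 hd
  rw [P.π_idem (idem_mul_inv s) hd] at hm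
  have : P.π s ⟨P.π s⁻¹ ⟨a, ha'⟩, (P.π s⁻¹ ⟨a, ha'⟩).2⟩ = ⟨a, ha⟩ := Subtype.ext hm
  rw [← this]; simp

/-- The ring `𝓛` of finite formal sums `∑ a_s δ_s` with `a_s ∈ D s`, as an additive group. -/
def FormalSum : Type _ := DirectSum S fun s => P.D s

noncomputable instance : AddCommGroup P.FormalSum :=
  inferInstanceAs (AddCommGroup (DirectSum S fun s => P.D s))

open scoped Classical in
/-- The homogeneous element `a δ_s`. -/
noncomputable def δ (s : S) : P.D s →+ P.FormalSum := DirectSum.of (fun s => P.D s) s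

open scoped Classical in
/-- The additive map on `𝓛` with prescribed values on homogeneous elements. -/
noncomputable def lift {B : Type*} [AddCommGroup B] (φ : ∀ s, P.D s →+ B) : P.FormalSum →+ B :=
  DirectSum.toAddMonoid (β := fun s => P.D s) φ

theorem lift_δ {B : Type*} [AddCommGroup B] (φ : ∀ s, P.D s →+ B) (s : S) (a : P.D s) :
    P.lift φ (P.δ s a) = φ s a := by
  classical
  exact DirectSum.toAddMonoid_of (β := fun s => P.D s) φ s a

theorem FormalSum.induction {P : RingPartialAction S A} {p : P.FormalSum → Prop}
    (x : P.FormalSum) (zero : p 0)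
    (δ_mem : ∀ s a, p (P.δ s a)) (add : ∀ x y, p x → p y → p (x + y)) : p x := by
  classical
  exact DirectSum.induction_on (motive := p) x zero (fun s a => δ_mem s a) add

/-- The product `π_{s⁻¹}(a) b`, which lies in the ideal `D s⁻¹`. -/
noncomputable def preMul {s t : S} (a : P.D s) (b : P.D t) : P.D s⁻¹ :=
  ⟨(P.π s).symm a * b, (P.D s⁻¹).mul_mem_right _ _ ((P.π s).symm a).2⟩

theorem π_preMul_mem {s t : S} (a : P.D s) (b : P.D t) :
    (P.π s (P.preMul a b) : A) ∈ P.D (s * t) := by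
  have : (P.π s (P.preMul a b) : A) ∈ (P.D s : Set A) ∩ P.D (s * t) := by
    rw [← P.image_inter]
    exact ⟨_, (P.D t).mul_mem_left _ _ b.2, rfl⟩
  exact this.2

/-- The coefficient `π_s (π_{s⁻¹}(a) b) ∈ D (s t)` of the product `(a δ_s) (b δ_t)`. -/
noncomputable def coeffMul {s t : S} (a : P.D s) (b : P.D t) : P.D (s * t) :=
  ⟨P.π s (P.preMul a b), P.π_preMul_mem a b⟩

/-- `coeffMul` as a biadditive map. -/
noncomputable def coeffMulHom (s t : S) : P.D s →+ P.D t →+ P.D (s * t) :=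
  AddMonoidHom.mk' (fun a => AddMonoidHom.mk' (fun b => P.coeffMul a b) (by
      intro b c
      have h : P.preMul a (b + c) = P.preMul a b + P.preMul a c :=
        Subtype.ext (mul_add _ _ _)
      apply Subtype.ext
      simp [coeffMul, h])) (by
    intro a a'
    ext b
    have h : P.preMul (a + a') b = P.preMul a b + P.preMul a' b :=
      Subtype.ext (by simp [preMul, add_mul])
    simp [coeffMul, h])

/-- The multiplication of `𝓛`: the biadditive extension of
`(a δ_s) (b δ_t) = π_s (π_{s⁻¹}(a) b) δ_{st}`. -/
noncomputable def mulHom : P.FormalSum →+ P.FormalSum →+ P.FormalSum :=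
  P.lift fun s => AddMonoidHom.flip <| P.lift fun t =>
    AddMonoidHom.flip ((P.δ (s * t)).compHom.comp (P.coeffMulHom s t))

noncomputable instance : Mul P.FormalSum := ⟨fun x y => P.mulHom x y⟩

noncomputable instance : NonUnitalNonAssocRing P.FormalSum where
  left_distrib x y z := map_add (P.mulHom x) y z
  right_distrib x y z := by
    change P.mulHom (x + y) z = P.mulHom x z + P.mulHom y z
    rw [map_add]; rfl
  zero_mul x := by
    change P.mulHom 0 x = 0
    rw [map_zero]; rfl
  mul_zero x := map_zero (P.mulHom x)

theorem δ_mul_δ {s t : S} (a : P.D s) (b : P.D t) :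
    P.δ s a * P.δ t b = P.δ (s * t) (P.coeffMul a b) := by
  change P.mulHom (P.δ s a) (P.δ t b) = _
  rw [mulHom, lift_δ, AddMonoidHom.flip_apply, lift_δ]
  rfl

/-- The elements `a δ_r - a δ_s` with `r ≤ s` and `a ∈ D r` (so that also `a ∈ D s`). -/
def relSet : Set P.FormalSum :=
  {x | ∃ (r s : S) (_ : NatLE r s) (a : A) (hr : a ∈ P.D r) (hs : a ∈ P.D s),
    x = P.δ r ⟨a, hr⟩ - P.δ s ⟨a, hs⟩}

/-- The ideal `𝓝` of `𝓛` generated by the elements `a δ_r - a δ_s`. -/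
noncomputable def relIdeal : TwoSidedIdeal P.FormalSum := TwoSidedIdeal.span P.relSet

/-- The skew inverse semigroup ring `A ⋊ S = 𝓛 / 𝓝`. -/
def SkewRing : Type _ := P.relIdeal.ringCon.Quotient

noncomputable instance : NonUnitalNonAssocRing P.SkewRing :=
  inferInstanceAs (NonUnitalNonAssocRing P.relIdeal.ringCon.Quotient)

/-- The quotient map `𝓛 → A ⋊ S`, `x ↦ x̄`. -/
noncomputable def toSkew (x : P.FormalSum) : P.SkewRing := (x : P.relIdeal.ringCon.Quotient)

/-- The additive map `τ : 𝓛 → A`, `∑ a_s δ_s ↦ ∑ a_s`. -/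
noncomputable def τ : P.FormalSum →+ A :=
  P.lift fun s => AddMonoidHom.mk' (fun a : P.D s => (a : A)) fun _ _ => rfl

theorem τ_δ {s : S} (a : P.D s) : P.τ (P.δ s a) = a := by
  rw [τ, lift_δ]; rfl

theorem closure_mul_left (x : P.FormalSum) {y : P.FormalSum}
    (hy : y ∈ AddSubgroup.closure P.relSet) : x * y ∈ AddSubgroup.closure P.relSet := by
  induction x using FormalSum.induction with
  | zero => rw [zero_mul]; exact zero_mem _
  | add x x' hx hx' => rw [add_mul]; exact add_mem hx hx'
  | δ_mem t b =>
    induction hy using AddSubgroup.closure_induction with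
    | zero => rw [mul_zero]; exact zero_mem _
    | add x x' _ _ hx hx' => rw [mul_add]; exact add_mem hx hx'
    | neg x _ hx => rw [mul_neg]; exact neg_mem hx
    | mem x hx =>
      obtain ⟨r, s, h, a, hr, hs, rfl⟩ := hx
      rw [mul_sub, δ_mul_δ, δ_mul_δ]
      exact AddSubgroup.subset_closure ⟨_, _, h.mul_left t, _, _, _, rfl⟩

theorem closure_mul_right {x : P.FormalSum} (y : P.FormalSum)
    (hx : x ∈ AddSubgroup.closure P.relSet) : x * y ∈ AddSubgroup.closure P.relSet := by
  induction y using FormalSum.induction with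
  | zero => rw [mul_zero]; exact zero_mem _
  | add x x' hx hx' => rw [mul_add]; exact add_mem hx hx'
  | δ_mem u c =>
    induction hx using AddSubgroup.closure_induction with
    | zero => rw [zero_mul]; exact zero_mem _
    | add x x' _ _ hx hx' => rw [add_mul]; exact add_mem hx hx'
    | neg x _ hx => rw [neg_mul]; exact neg_mem hx
    | mem x hx =>
      obtain ⟨r, s, h, a, hr, hs, rfl⟩ := hx
      rw [sub_mul, δ_mul_δ, δ_mul_δ]
      have hpre : (P.preMul (⟨a, hr⟩ : P.D r) c : A) = P.preMul (⟨a, hs⟩ : P.D s) c := by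
        simp only [preMul, P.π_symm_restrict h hr hs]
      have hco : (P.coeffMul (⟨a, hr⟩ : P.D r) c : A) = P.coeffMul (⟨a, hs⟩ : P.D s) c := by
        have h1 := P.π_restrict h (P.preMul (⟨a, hr⟩ : P.D r) c).2
          (P.D_inv_mono h (P.preMul (⟨a, hr⟩ : P.D r) c).2)
        refine h1.trans ?_
        change _ = (P.π s (P.preMul (⟨a, hs⟩ : P.D s) c) : A)
        congr 2
        exact Subtype.ext hpre
      refine AddSubgroup.subset_closure ⟨_, _, h.mul_right u, P.coeffMul (⟨a, hr⟩ : P.D r) c,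
        Subtype.prop _, ?_, ?_⟩
      · rw [hco]; exact Subtype.prop _
      · congr 2
        exact Subtype.ext hco.symm

theorem τ_eq_zero {x : P.FormalSum} (hx : x ∈ P.relIdeal) : P.τ x = 0 := by
  have hle : P.relIdeal ≤ TwoSidedIdeal.mk' (AddSubgroup.closure P.relSet : Set P.FormalSum)
      (zero_mem _) add_mem neg_mem (fun h => P.closure_mul_left _ h)
      (fun h => P.closure_mul_right _ h) := by
    refine TwoSidedIdeal.span_le.2 fun y hy => ?_
    rw [SetLike.mem_coe, TwoSidedIdeal.mem_mk']
    exact AddSubgroup.subset_closure hy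
  have hx' := hle hx
  rw [TwoSidedIdeal.mem_mk', SetLike.mem_coe] at hx'
  have hker : AddSubgroup.closure P.relSet ≤ P.τ.ker := by
    refine (AddSubgroup.closure_le _).2 ?_
    rintro y ⟨r, s, h, a, hr, hs, rfl⟩
    rw [SetLike.mem_coe, AddMonoidHom.mem_ker, map_sub, τ_δ, τ_δ, sub_self]
  exact hker hx'

/-- The additive map `τ̃ : A ⋊ S → A` induced by `τ`. -/
noncomputable def τQuot : P.SkewRing →+ A :=
  AddMonoidHom.mk' (Quotient.lift (fun x : P.FormalSum => P.τ x) (by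
      intro x y h
      have h' := P.τ_eq_zero ((P.relIdeal.rel_iff x y).1 h)
      rwa [map_sub, sub_eq_zero] at h')) (by
    rintro ⟨x⟩ ⟨y⟩
    exact map_add P.τ x y)

theorem τQuot_toSkew (x : P.FormalSum) : P.τQuot (P.toSkew x) = P.τ x := rfl

end RingPartialAction

/-! ### Topological partial actions -/

/-- A topological partial action of `S` on `X`: open sets `dom s` and homeomorphisms
`θ s : dom s⁻¹ → dom s` (as open partial homeomorphisms of `X`) such that the `dom e` with `e`
idempotent cover `X`, `θ s (dom s⁻¹ ∩ dom t) = dom s ∩ dom (s t)`, and `θ s (θ t x) = θ (s t) x`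
for `x ∈ dom t⁻¹ ∩ dom (t⁻¹ s⁻¹)`. -/
structure TopologicalPartialAction (S : Type*) [InverseSemigroup S]
    (X : Type*) [TopologicalSpace X] where
  dom : S → Set X
  θ : S → OpenPartialHomeomorph X X
  source_eq : ∀ s, (θ s).source = dom s⁻¹
  target_eq : ∀ s, (θ s).target = dom s
  iUnion_dom : ⋃ e ∈ {e : S | IsIdempotentElem e}, dom e = Set.univ
  image_inter : ∀ s t, θ s '' (dom s⁻¹ ∩ dom t) = dom s ∩ dom (s * t)
  map_map : ∀ s t, ∀ x ∈ dom t⁻¹ ∩ dom (t⁻¹ * s⁻¹), θ s (θ t x) = θ (s * t) x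

theorem isClosed_support_of_locallyConstant {X R : Type*} [TopologicalSpace X] [Zero R]
    (f : LocallyConstant X R) : IsClosed (support f) := by
  have := (f.isLocallyConstant.isOpen_fiber 0).isClosed_compl
  exact this

/-- The `R`-algebra `L_c(X)` of locally constant, compactly supported functions `X → R`, where the
support of `f` is the (clopen) set where `f ≠ 0`. -/
def Lc (X : Type*) [TopologicalSpace X] (R : Type*) [CommRing R] :
    NonUnitalSubalgebra R (LocallyConstant X R) where
  carrier := {f | IsCompact (support f)}
  add_mem' {f g} hf hg := (hf.union hg).of_isClosed_subset
    (isClosed_support_of_locallyConstant _) (support_add _ _)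
  zero_mem' := by
    change IsCompact (support (fun _ : X => (0 : R)))
    simp
  mul_mem' {f g} hf hg := hf.of_isClosed_subset
    (isClosed_support_of_locallyConstant _) (support_mul_subset_left _ _)
  smul_mem' c f hf := hf.of_isClosed_subset
    (isClosed_support_of_locallyConstant _) (support_const_smul_subset _ _)

namespace TopologicalPartialAction

variable {S : Type*} [InverseSemigroup S] {X : Type*} [TopologicalSpace X]
  (T : TopologicalPartialAction S X)

/-- `U ⊆ X` is invariant if `θ s (U ∩ dom s⁻¹) ⊆ U` for all `s`. -/
def IsInvariant (U : Set X) : Prop := ∀ s, T.θ s '' (U ∩ T.dom s⁻¹) ⊆ U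

/-- There is no non-empty, proper, open invariant subset. -/
def IsMinimal : Prop :=
  ∀ U : Set X, IsOpen U → T.IsInvariant U → U = ∅ ∨ U = Set.univ

/-- The points `x` such that every `s` with `x ∈ dom s⁻¹` and `θ s x = x` lies above some
idempotent `e` with `x ∈ dom e`. -/
def principalSet : Set X :=
  {x | ∀ s, x ∈ T.dom s⁻¹ → T.θ s x = x → ∃ e, IsIdempotentElem e ∧ NatLE e s ∧ x ∈ T.dom e}

def IsTopologicallyPrincipal : Prop := Dense T.principalSet

theorem isOpen_dom (s : S) : IsOpen (T.dom s) := by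
  rw [← T.target_eq]; exact (T.θ s).open_target

theorem mapsTo {s : S} {x : X} (hx : x ∈ T.dom s⁻¹) : T.θ s x ∈ T.dom s := by
  rw [← T.target_eq]; rw [← T.source_eq] at hx; exact (T.θ s).map_source hx

theorem injOn (s : S) {x y : X} (hx : x ∈ T.dom s⁻¹) (hy : y ∈ T.dom s⁻¹)
    (h : T.θ s x = T.θ s y) : x = y := by
  rw [← T.source_eq] at hx hy; exact (T.θ s).injOn hx hy h

theorem dom_le {s : S} {x : X} (hx : x ∈ T.dom s) : x ∈ T.dom (s * s⁻¹) := by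
  have h := T.image_inter s s⁻¹
  have : x ∈ T.θ s '' (T.dom s⁻¹ ∩ T.dom s⁻¹) := by
    rw [← T.target_eq] at hx
    have hs := (T.θ s).map_target hx
    rw [T.source_eq] at hs
    exact ⟨_, ⟨hs, hs⟩, (T.θ s).right_inv hx⟩
  rw [h] at this
  exact this.2

theorem θ_idem {e : S} (he : IsIdempotentElem e) {x : X} (hx : x ∈ T.dom e) : T.θ e x = x := by
  have hi := inv_idem he
  have h := T.map_map e e x (by rw [hi, he.eq]; exact ⟨hx, hx⟩)
  rw [he.eq] at h
  exact T.injOn e (by rw [hi]; exact T.mapsTo (by rwa [hi])) (by rwa [hi]) h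

theorem dom_inter_idem {e : S} (he : IsIdempotentElem e) (t : S) {x : X} (hx : x ∈ T.dom e) :
    x ∈ T.dom (e * t) ↔ x ∈ T.dom t := by
  have h := T.image_inter e t
  rw [inv_idem he] at h
  constructor
  · intro hxt
    obtain ⟨y, hy, rfl⟩ := h.ge ⟨hx, hxt⟩
    rw [T.θ_idem he hy.1]; exact hy.2
  · intro hxt
    exact (h.le ⟨x, ⟨hx, hxt⟩, T.θ_idem he hx⟩).2

/-- `θ s⁻¹` is the inverse of `θ s`. -/
theorem θ_inv_apply {s : S} {x : X} (hx : x ∈ T.dom s⁻¹) : T.θ s⁻¹ (T.θ s x) = x := by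
  have h := T.map_map s⁻¹ s x ⟨hx, by rw [invInv]; simpa only [invInv] using T.dom_le hx⟩
  have h' := T.dom_le hx
  rw [invInv] at h'
  rw [h, T.θ_idem (idem_inv_mul s) h']

theorem θ_apply_inv {s : S} {x : X} (hx : x ∈ T.dom s) : T.θ s (T.θ s⁻¹ x) = x := by
  have := T.θ_inv_apply (s := s⁻¹) (x := x) (by rwa [invInv])
  rwa [invInv] at this

theorem mapsTo_inv {s : S} {x : X} (hx : x ∈ T.dom s) : T.θ s⁻¹ x ∈ T.dom s⁻¹ :=
  T.mapsTo (by rwa [invInv])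

theorem θ_mem_inv {s t : S} {x : X} (hx : x ∈ T.dom t⁻¹) (hx' : x ∈ T.dom (t⁻¹ * s⁻¹)) :
    T.θ t x ∈ T.dom s⁻¹ := by
  have h := T.image_inter t (t⁻¹ * s⁻¹)
  have hm := (h.le ⟨x, ⟨hx, hx'⟩, rfl⟩).2
  rw [← mul_assoc] at hm
  exact (T.dom_inter_idem (idem_mul_inv t) s⁻¹ (T.dom_le (T.mapsTo hx))).1 hm

variable (R : Type*) [CommRing R]

/-- The ideal of those `f` in `L_c(X)` with support contained in the open set `dom s`. -/
def ideal (s : S) : TwoSidedIdeal (Lc X R) :=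
  TwoSidedIdeal.mk' {f | support f.1 ⊆ T.dom s}
    (by simp)
    (fun {f g} hf hg => (support_add _ _).trans (Set.union_subset hf hg))
    (fun {f} hf => by
      change support (-(f.1 : X → R)) ⊆ _
      rw [support_neg]; exact hf)
    (fun {f g} hg => (support_mul_subset_right _ _).trans hg)
    (fun {f g} hf => (support_mul_subset_left _ _).trans hf)

theorem mem_ideal {s : S} {f : Lc X R} : f ∈ T.ideal R s ↔ support f.1 ⊆ T.dom s := by
  rw [ideal, TwoSidedIdeal.mem_mk']; rfl

theorem apply_eq_zero {s : S} {f : Lc X R} (hf : f ∈ T.ideal R s) {x : X} (hx : x ∉ T.dom s) :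
    f.1 x = 0 := by
  by_contra h
  exact hx ((T.mem_ideal R).1 hf h)

open scoped Classical in
/-- The function equal to `f ∘ θ s⁻¹` on `dom s` and to `0` off `dom s`. -/
noncomputable def pullFun (s : S) (f : X → R) (x : X) : R :=
  if x ∈ T.dom s then f (T.θ s⁻¹ x) else 0

theorem support_pullFun (s : S) {f : X → R} (hf : support f ⊆ T.dom s⁻¹) :
    support (T.pullFun R s f) = T.θ s '' support f := by
  ext x
  simp only [mem_support, pullFun, Set.mem_image]
  constructor
  · intro h
    split_ifs at h with hx
    · exact ⟨_, h, T.θ_apply_inv hx⟩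
    · exact absurd rfl h
  · rintro ⟨y, hy, rfl⟩
    rw [if_pos (T.mapsTo (hf hy)), T.θ_inv_apply (hf hy)]
    exact hy

theorem isCompact_support_pullFun (s : S) {f : X → R} (hf : support f ⊆ T.dom s⁻¹)
    (hc : IsCompact (support f)) : IsCompact (support (T.pullFun R s f)) := by
  rw [T.support_pullFun R s hf]
  refine hc.image_of_continuousOn ((T.θ s).continuousOn.mono ?_)
  rwa [T.source_eq]

theorem isLocallyConstant_pullFun [T2Space X] (s : S) {f : X → R} (hl : IsLocallyConstant f)
    (hf : support f ⊆ T.dom s⁻¹) (hc : IsCompact (support f)) :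
    IsLocallyConstant (T.pullFun R s f) := by
  rw [IsLocallyConstant.iff_eventually_eq]
  intro x
  by_cases hx : x ∈ T.dom s
  · have hcont : ContinuousAt (T.θ s⁻¹) x :=
      (T.θ s⁻¹).continuousAt (by rwa [T.source_eq, invInv])
    filter_upwards [(T.isOpen_dom s).mem_nhds hx,
      hcont.eventually ((IsLocallyConstant.iff_eventually_eq f).1 hl _)] with y hy hy'
    simp only [pullFun, if_pos hx, if_pos hy]
    exact hy'
  · have hcl := (T.isCompact_support_pullFun R s hf hc).isClosed
    have h0 : x ∉ support (T.pullFun R s f) := by simp [pullFun, hx]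
    filter_upwards [hcl.isOpen_compl.mem_nhds h0] with y hy
    rw [notMem_support.1 h0, notMem_support.1 hy]

/-- `pullFun` as a map between the ideals of `L_c(X)` attached to `dom s⁻¹` and `dom s`. -/
noncomputable def pull [T2Space X] {s t : S} (hst : t = s⁻¹) (f : T.ideal R t) : T.ideal R s :=
  have hf : support (f : Lc X R).1 ⊆ T.dom s⁻¹ := by rw [← hst]; exact (T.mem_ideal R).1 f.2
  ⟨⟨⟨T.pullFun R s f.1.1, T.isLocallyConstant_pullFun R s f.1.1.isLocallyConstant hf f.1.2⟩,
    T.isCompact_support_pullFun R s hf f.1.2⟩, by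
      rw [mem_ideal]
      change support (T.pullFun R s f.1.1) ⊆ _
      rw [T.support_pullFun R s hf]
      rintro _ ⟨y, hy, rfl⟩
      exact T.mapsTo (hf hy)⟩

open scoped Classical in
theorem pull_apply [T2Space X] {s t : S} (hst : t = s⁻¹) (f : T.ideal R t) (x : X) :
    (T.pull R hst f : Lc X R).1 x = if x ∈ T.dom s then (f : Lc X R).1 (T.θ s⁻¹ x) else 0 := rfl

theorem Lc_ext {f g : Lc X R} (h : ∀ x, f.1 x = g.1 x) : f = g :=
  Subtype.ext (LocallyConstant.ext h)

/-- The ring isomorphism `α s`: it sends `f`, supported in `dom s⁻¹`, to the function equal to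
`f ∘ θ s⁻¹` on `dom s` and to `0` off `dom s`. -/
noncomputable def αIso [T2Space X] (s : S) : T.ideal R s⁻¹ ≃+* T.ideal R s where
  toFun := T.pull R rfl
  invFun := T.pull R (invInv s).symm
  left_inv f := by
    refine Subtype.ext (Lc_ext R fun x => ?_)
    rw [pull_apply]
    split_ifs with hx
    · rw [pull_apply, invInv, if_pos (T.mapsTo hx), T.θ_inv_apply hx]
    · exact (T.apply_eq_zero R f.2 hx).symm
  right_inv f := by
    refine Subtype.ext (Lc_ext R fun x => ?_)
    rw [pull_apply]
    split_ifs with hx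
    · rw [pull_apply, invInv, if_pos (T.mapsTo_inv hx), T.θ_apply_inv hx]
    · exact (T.apply_eq_zero R f.2 hx).symm
  map_mul' f g := by
    refine Subtype.ext (Lc_ext R fun x => ?_)
    change (T.pull R rfl (f * g) : Lc X R).1 x =
      (T.pull R rfl f : Lc X R).1 x * (T.pull R rfl g : Lc X R).1 x
    simp only [pull_apply]
    split_ifs
    · rfl
    · simp
  map_add' f g := by
    refine Subtype.ext (Lc_ext R fun x => ?_)
    change (T.pull R rfl (f + g) : Lc X R).1 x =
      (T.pull R rfl f : Lc X R).1 x + (T.pull R rfl g : Lc X R).1 x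
    simp only [pull_apply]
    split_ifs
    · rfl
    · simp

open scoped Classical in
theorem αIso_apply [T2Space X] (s : S) (f : T.ideal R s⁻¹) (x : X) :
    (T.αIso R s f : Lc X R).1 x = if x ∈ T.dom s then (f : Lc X R).1 (T.θ s⁻¹ x) else 0 := rfl

open scoped Classical in
/-- The restriction of `f` to a clopen set. -/
noncomputable def cut {U : Set X} (hU : IsClopen U) (f : Lc X R) : Lc X R :=
  ⟨LocallyConstant.charFn R hU * f.1, f.2.of_isClosed_subset
    (isClosed_support_of_locallyConstant _) (support_mul_subset_right _ _)⟩

open scoped Classical in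
theorem cut_apply {U : Set X} (hU : IsClopen U) (f : Lc X R) (x : X) :
    (cut R hU f).1 x = if x ∈ U then f.1 x else 0 := by
  change LocallyConstant.charFn R hU x * f.1 x = _
  rw [LocallyConstant.coe_charFn, Set.indicator_apply]
  split_ifs <;> simp

theorem closure_ideal [T2Space X] [PrespectralSpace X] :
    AddSubgroup.closure (⋃ e ∈ {e : S | IsIdempotentElem e}, (T.ideal R e : Set (Lc X R))) = ⊤ := by
  classical
  obtain ⟨H, hH⟩ : ∃ H, H = AddSubgroup.closure
    (⋃ e ∈ {e : S | IsIdempotentElem e}, (T.ideal R e : Set (Lc X R))) := ⟨_, rfl⟩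
  rw [← hH, eq_top_iff]
  intro f _
  have key : ∃ U : Set X, IsClopen U ∧ support f.1 ⊆ U ∧
      ∀ g : Lc X R, support g.1 ⊆ U → g ∈ H := by
    refine IsCompact.induction_on (p := fun K => ∃ U : Set X, IsClopen U ∧ K ⊆ U ∧
      ∀ g : Lc X R, support g.1 ⊆ U → g ∈ H) f.2 ?_ ?_ ?_ ?_
    · refine ⟨∅, isClopen_empty, subset_rfl, fun g hg => ?_⟩
      have : g = 0 := Lc_ext R fun x => by
        by_contra h
        exact hg h
      rw [this]; exact zero_mem _
    · rintro K L hKL ⟨U, hU, hLU, h⟩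
      exact ⟨U, hU, hKL.trans hLU, h⟩
    · rintro K L ⟨U, hU, hKU, h⟩ ⟨V, hV, hLV, h'⟩
      refine ⟨U ∪ V, hU.union hV, Set.union_subset_union hKU hLV, fun g hg => ?_⟩
      have hg' : g = cut R hU g + cut R (hV.diff hU) g := Lc_ext R fun x => by
        change _ = (cut R hU g).1 x + (cut R (hV.diff hU) g).1 x
        rw [cut_apply, cut_apply]
        by_cases hxU : x ∈ U
        · simp [hxU]
        · by_cases hxV : x ∈ V
          · simp [hxU, hxV]
          · have : g.1 x = 0 := by
              by_contra h0
              exact (hg h0).elim hxU hxV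
            simp [this]
      rw [hg']
      refine add_mem (h _ fun x hx => ?_) (h' _ fun x hx => ?_)
      · by_contra hxU
        rw [mem_support, cut_apply, if_neg hxU] at hx
        exact hx rfl
      · by_contra hxV
        rw [mem_support, cut_apply, if_neg (fun h => hxV h.1)] at hx
        exact hx rfl
    · intro x _
      have hx : x ∈ ⋃ e ∈ {e : S | IsIdempotentElem e}, T.dom e := by
        rw [T.iUnion_dom]; trivial
      simp only [Set.mem_iUnion] at hx
      obtain ⟨e, he, hxe⟩ := hx
      obtain ⟨V, ⟨hVo, hVc⟩, hxV, hVe⟩ :=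
        (PrespectralSpace.isTopologicalBasis (X := X)).mem_nhds_iff.1
          ((T.isOpen_dom e).mem_nhds hxe)
      refine ⟨V, mem_nhdsWithin_of_mem_nhds (hVo.mem_nhds hxV), V, ⟨hVc.isClosed, hVo⟩,
        subset_rfl, fun g hg => ?_⟩
      rw [hH]
      refine AddSubgroup.subset_closure ?_
      simp only [Set.mem_iUnion]
      exact ⟨e, he, (T.mem_ideal R).2 (hg.trans hVe)⟩
  obtain ⟨U, _, hfU, h⟩ := key
  exact h f hfU

/-- The partial action `α` of `S` on `L_c(X)` associated with a topological partial action `θ` on a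
Hausdorff space with a basis of compact-open sets. -/
noncomputable def α [T2Space X] [PrespectralSpace X] : RingPartialAction S (Lc X R) where
  D := T.ideal R
  π := T.αIso R
  closure_iUnion := T.closure_ideal R
  image_inter s t := by
    classical
    ext g
    constructor
    · rintro ⟨f, hf, rfl⟩
      refine ⟨(T.αIso R s f).2, (T.mem_ideal R).2 ?_⟩
      intro x hx
      rw [mem_support, αIso_apply] at hx
      split_ifs at hx with hxs
      · have h1 := (T.mem_ideal R).1 hf hx
        have := (T.image_inter s t).le ⟨_, ⟨T.mapsTo_inv hxs, h1⟩, rfl⟩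
        rw [T.θ_apply_inv hxs] at this
        exact this.2
      · exact absurd rfl hx
    · rintro ⟨hg, hg'⟩
      refine ⟨(T.αIso R s).symm ⟨g, hg⟩, (T.mem_ideal R).2 fun x hx => ?_, by simp⟩
      have hxs : x ∈ T.dom s⁻¹ := (T.mem_ideal R).1 ((T.αIso R s).symm ⟨g, hg⟩).2 hx
      have hgx : g.1 (T.θ s x) ≠ 0 := by
        have h1 : g.1 (T.θ s x) = (T.αIso R s ((T.αIso R s).symm ⟨g, hg⟩) : Lc X R).1 (T.θ s x) := by
          rw [RingEquiv.apply_symm_apply]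
        rw [h1, αIso_apply, if_pos (T.mapsTo hxs), T.θ_inv_apply hxs]
        exact hx
      obtain ⟨y, hy, hyx⟩ := (T.image_inter s t).ge ⟨T.mapsTo hxs, (T.mem_ideal R).1 hg' hgx⟩
      rw [← T.injOn s hy.1 hxs hyx]
      exact hy.2
  map_map s t f hf hf' h h' := by
    classical
    refine Lc_ext R fun x => ?_
    refine (T.αIso_apply R s _ x).trans ((?_ : _ = _).trans (T.αIso_apply R (s * t) _ x).symm)
    by_cases hx : x ∈ T.dom s ∧ T.θ s⁻¹ x ∈ T.dom t
    · have hst := (T.image_inter s t).le ⟨_, ⟨T.mapsTo_inv hx.1, hx.2⟩, rfl⟩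
      rw [T.θ_apply_inv hx.1] at hst
      rw [if_pos hx.1, if_pos hst.2]
      change (T.αIso R t ⟨f, hf⟩ : Lc X R).1 _ = _
      rw [αIso_apply, if_pos hx.2, T.map_map t⁻¹ s⁻¹ x (by rw [invInv, invInv]; exact hst)]
      change f.1 _ = f.1 _
      rw [mulInv]
    · have h0 : (if x ∈ T.dom s then (T.αIso R t ⟨f, hf⟩ : Lc X R).1 (T.θ s⁻¹ x) else 0) = 0 := by
        split_ifs with hxs
        · rw [αIso_apply, if_neg (fun h => hx ⟨hxs, h⟩)]
        · rfl
      refine h0.trans ?_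
      split_ifs with hxst
      · by_contra hne
        have hy : f.1 (T.θ (s * t)⁻¹ x) ≠ 0 := fun h => hne h.symm
        have hy1 := (T.mem_ideal R).1 hf hy
        have hy2 := (T.mem_ideal R).1 hf' hy
        have hy3 := T.θ_mem_inv hy1 hy2
        have hxe : T.θ s (T.θ t (T.θ (s * t)⁻¹ x)) = x := by
          rw [T.map_map s t _ ⟨hy1, hy2⟩, T.θ_apply_inv hxst]
        apply hx
        constructor
        · rw [← hxe]; exact T.mapsTo hy3
        · have : T.θ s⁻¹ x = T.θ t (T.θ (s * t)⁻¹ x) := by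
            conv_lhs => rw [← hxe]
            exact T.θ_inv_apply hy3
          rw [this]; exact T.mapsTo hy1
      · rfl

end TopologicalPartialAction

/-! The skew ring should be read as a convolution ring of germs: a homogeneous element `a δ_s` puts
the coefficient `a x` on the germ of `s` with range `x` and source `θ_{s⁻¹} x`, and the relations in
`𝓝` say that restricting `s` does not change its germs.

Necessity. The ring acts on all functions `X → R` by `(a δ_s) h = a · (h ∘ θ_{s⁻¹})` (`rep`). For an
invariant set `U`, the elements whose action vanishes off `U` form a two-sided ideal, proper if `U ≠
X` and non-zero if `U` is open and non-empty; simplicity therefore gives minimality. The case `U =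
∅` shows that the action is faithful. If `s` fixes a compact-open `V` pointwise, then `1_V δ_s - 1_V
δ_{s⁻¹s}` acts as zero, so it is zero, and the functional `unitGerm` then forces every germ of `s`
over `V` to be a unit. Hence the fixed points of `s` with non-unit germ are nowhere dense, and
countability of `S` with the Baire property yields a dense set of points with trivial isotropy. The
third condition is immediate, the only non-zero ideal being the whole ring.

Sufficiency. Let `f` lie in an ideal `I` with `τ̃ f ≠ 0`. The open support of `τ̃ f` contains a
point `x` with trivial isotropy, where a germ with range `x` is determined by its source. Grouping
the coefficients of `f` at `x` by source (`fiberSum`), some group has a non-zero sum `c`;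
multiplying `f` on both sides by characteristic functions of small sets around the range and the
source leaves `c 1_V δ_s`, a non-zero homogeneous element of `I` (`exists_single_mem`). Because `R`
is a field, such an element brings into `I` every homogeneous element with smaller support. The
union of all supports obtained is open and invariant, hence equal to `X` by minimality, and
compactness of supports gives the whole ring (`eq_top_of_single_mem`). -/

namespace InverseSemigroup

variable {S : Type*} [InverseSemigroup S]

/-! ### The natural partial order of an inverse semigroup -/

theorem natLE_mul_idem (s : S) {f : S} (hf : IsIdempotentElem f) : NatLE (s * f) s := by
  unfold NatLE
  rw [mulInv, inv_idem hf]
  calc s * f = s * s⁻¹ * s * (f * f) := by rw [mul_inv_mul, hf.eq]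
    _ = s * (s⁻¹ * s * f) * f := by simp only [mul_assoc]
    _ = s * (f * s⁻¹ * (s * f)) := by
      rw [idem_comm (idem_inv_mul s) hf]; simp only [mul_assoc]

theorem natLE_idem_mul (s : S) {e : S} (he : IsIdempotentElem e) : NatLE (e * s) s := by
  unfold NatLE
  rw [mulInv, inv_idem he]
  calc e * s = e * e * (s * s⁻¹) * s := by rw [he.eq, mul_assoc e, mul_inv_mul]
    _ = e * (e * (s * s⁻¹)) * s := by simp only [mul_assoc]
    _ = s * s⁻¹ * (e * e) * s := by
      rw [idem_comm he (idem_mul_inv s), ← mul_assoc, idem_comm he (idem_mul_inv s)]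
      simp only [mul_assoc]
    _ = s * (s⁻¹ * e * (e * s)) := by simp only [mul_assoc]

theorem NatLE.refl (s : S) : NatLE s s := by
  unfold NatLE; rw [← mul_assoc, mul_inv_mul]

theorem NatLE.trans {r s t : S} (h : NatLE r s) (h' : NatLE s t) : NatLE r t := by
  have : r = t * (s⁻¹ * s * (r⁻¹ * r)) := by
    rw [← mul_assoc, ← h', ← h]
  rw [this]
  exact natLE_mul_idem t (idem_mul (idem_inv_mul s) (idem_inv_mul r))

/-- The order is defined by restricting sources, that is, by an idempotent on the right. Since
idempotents commute, the same restriction can be made on the range side, which suits the sets `dom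
s`, the ranges of the maps `θ s`. -/
theorem NatLE.eq_idem_mul {r s : S} (h : NatLE r s) : r * r⁻¹ * s = r := by
  have hf := idem_inv_mul r
  obtain ⟨f, hf'⟩ : ∃ f, f = r⁻¹ * r := ⟨_, rfl⟩
  have hr : r = s * f := by rw [hf']; exact h
  rw [← hf'] at hf
  rw [hr, mulInv, inv_idem hf]
  calc s * f * (f * s⁻¹) * s = s * (f * f) * s⁻¹ * s := by simp only [mul_assoc]
    _ = s * (f * (s⁻¹ * s)) := by rw [hf.eq]; simp only [mul_assoc]
    _ = s * s⁻¹ * s * f := by rw [idem_comm hf (idem_inv_mul s)]; simp only [mul_assoc]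
    _ = s * f := by rw [mul_inv_mul]

end InverseSemigroup

/-! ### Additive maps out of the skew ring -/

namespace RingPartialAction

variable {S : Type*} [InverseSemigroup S] {A : Type*} [NonUnitalRing A]
  (P : RingPartialAction S A)

theorem toSkew_surjective : Surjective P.toSkew := Quotient.mk_surjective

theorem toSkew_eq_iff {x y : P.FormalSum} : P.toSkew x = P.toSkew y ↔ x - y ∈ P.relIdeal :=
  (RingCon.eq _).trans (P.relIdeal.rel_iff x y)

theorem toSkew_δ_eq_of_natLE {r s : S} (h : NatLE r s) {a : A} (hr : a ∈ P.D r) (hs : a ∈ P.D s) :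
    P.toSkew (P.δ r ⟨a, hr⟩) = P.toSkew (P.δ s ⟨a, hs⟩) :=
  P.toSkew_eq_iff.2 (TwoSidedIdeal.subset_span ⟨r, s, h, a, hr, hs, rfl⟩)

/-- An additive map that vanishes on the defining relations vanishes on the ideal they generate. -/
theorem map_eq_zero_of_mem_relIdeal {B : Type*} [AddCommGroup B] (φ : P.FormalSum →+ B)
    (h : ∀ r s, NatLE r s → ∀ (a : A) (hr : a ∈ P.D r) (hs : a ∈ P.D s),
      φ (P.δ r ⟨a, hr⟩) = φ (P.δ s ⟨a, hs⟩))
    {x : P.FormalSum} (hx : x ∈ P.relIdeal) : φ x = 0 := by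
  -- The additive subgroup generated by the relations already absorbs multiplication on both sides,
  -- so the ideal is no larger and additivity of `φ` suffices.
  have hle : P.relIdeal ≤ TwoSidedIdeal.mk' (AddSubgroup.closure P.relSet : Set P.FormalSum)
      (zero_mem _) add_mem neg_mem (fun h => P.closure_mul_left _ h)
      (fun h => P.closure_mul_right _ h) := by
    refine TwoSidedIdeal.span_le.2 fun y hy => ?_
    rw [SetLike.mem_coe, TwoSidedIdeal.mem_mk']
    exact AddSubgroup.subset_closure hy
  have hx' := hle hx
  rw [TwoSidedIdeal.mem_mk', SetLike.mem_coe] at hx'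
  have hker : AddSubgroup.closure P.relSet ≤ φ.ker := by
    refine (AddSubgroup.closure_le _).2 ?_
    rintro y ⟨r, s, hrs, a, hr, hs, rfl⟩
    rw [SetLike.mem_coe, AddMonoidHom.mem_ker, map_sub, h r s hrs a hr hs, sub_self]
  exact hker hx'

end RingPartialAction

/-! ### Germs of the partial action -/

namespace TopologicalPartialAction

variable {S : Type*} [InverseSemigroup S] {X : Type*} [TopologicalSpace X]
  (T : TopologicalPartialAction S X)

theorem dom_inv_mul {s : S} {x : X} (hx : x ∈ T.dom s⁻¹) : x ∈ T.dom (s⁻¹ * s) := by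
  have := T.dom_le hx
  rwa [invInv] at this

theorem dom_mono {r s : S} (h : NatLE r s) {x : X} (hx : x ∈ T.dom r) : x ∈ T.dom s := by
  rw [← T.dom_inter_idem (idem_mul_inv r) s (T.dom_le hx), h.eq_idem_mul]
  exact hx

/-- From `r ≤ s` one gets `r⁻¹ = r⁻¹ * r * s⁻¹`, and the idempotent `r⁻¹ * r` acts as the identity.
This makes germwise constructions respect the relations in `𝓝`. -/
theorem θ_inv_restrict {r s : S} (h : NatLE r s) {x : X} (hx : x ∈ T.dom r) :
    T.θ r⁻¹ x = T.θ s⁻¹ x := by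
  have hf := idem_inv_mul r
  have hr : r⁻¹ * r * s⁻¹ = r⁻¹ := by
    have h' : r⁻¹ = (s * (r⁻¹ * r))⁻¹ := congrArg _ h
    rw [mulInv, inv_idem hf] at h'
    exact h'.symm
  have hx1 : x ∈ T.dom s⁻¹⁻¹ := by rw [invInv]; exact T.dom_mono h hx
  have hx2 : x ∈ T.dom (s⁻¹⁻¹ * (r⁻¹ * r)⁻¹) := by
    rw [invInv, inv_idem hf, ← h]; exact hx
  have h1 := T.map_map (r⁻¹ * r) s⁻¹ x ⟨hx1, hx2⟩
  have h2 := T.θ_mem_inv hx1 hx2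
  rw [inv_idem hf] at h2
  rw [T.θ_idem hf h2, hr] at h1
  exact h1.symm

theorem dom_mul {s t : S} {x : X} (hx : x ∈ T.dom s) (ht : T.θ s⁻¹ x ∈ T.dom t) :
    x ∈ T.dom (s * t) := by
  have := (T.image_inter s t).le ⟨_, ⟨T.mapsTo_inv hx, ht⟩, rfl⟩
  rw [T.θ_apply_inv hx] at this
  exact this.2

theorem θ_inv_mul {s t : S} {x : X} (hx : x ∈ T.dom s) (ht : T.θ s⁻¹ x ∈ T.dom t) :
    T.θ t⁻¹ (T.θ s⁻¹ x) = T.θ (s * t)⁻¹ x := by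
  rw [mulInv]
  exact T.map_map t⁻¹ s⁻¹ x (by rw [invInv, invInv]; exact ⟨hx, T.dom_mul hx ht⟩)

/-- Two germs with the same range `x` and the same source agree if `x` has trivial isotropy. -/
theorem exists_natLE_of_mem_principalSet {x : X} (hx : x ∈ T.principalSet) {s t : S}
    (hs : x ∈ T.dom s) (ht : x ∈ T.dom t) (h : T.θ s⁻¹ x = T.θ t⁻¹ x) :
    ∃ r, NatLE r s ∧ NatLE r t ∧ x ∈ T.dom r := by
  have h1 : x ∈ T.dom (t * s⁻¹) := T.dom_mul ht (by rw [← h]; exact T.mapsTo_inv hs)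
  have h2 := T.map_map s t⁻¹ x (by rw [invInv]; exact ⟨ht, h1⟩)
  rw [← h, T.θ_apply_inv hs] at h2
  -- The element `s * t⁻¹` fixes `x`, so it lies above an idempotent `e` defined at `x`. Then `e *
  -- t` lies below `t` and below `s * t⁻¹ * t`, hence below `s`.
  obtain ⟨e, he, hle, hxe⟩ := hx (s * t⁻¹) (by rw [mulInv, invInv]; exact h1) h2.symm
  refine ⟨e * t, ?_, natLE_idem_mul t he, (T.dom_inter_idem he t hxe).2 ht⟩
  have : NatLE (e * t) (s * t⁻¹ * t) := hle.mul_right t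
  rw [mul_assoc] at this
  exact this.trans (natLE_mul_idem s (idem_inv_mul t))

theorem IsInvariant.notMem {U : Set X} (hU : T.IsInvariant U) {s : S} {x : X} (hx : x ∈ T.dom s)
    (hxU : x ∉ U) : T.θ s⁻¹ x ∉ U := fun h =>
  hxU (hU s ⟨_, ⟨h, T.mapsTo_inv hx⟩, T.θ_apply_inv hx⟩)

theorem isInvariant_empty : T.IsInvariant ∅ := fun s => by simp

theorem exists_idem (x : X) : ∃ e, IsIdempotentElem e ∧ x ∈ T.dom e := by
  have hx : x ∈ ⋃ e ∈ {e : S | IsIdempotentElem e}, T.dom e := by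
    rw [T.iUnion_dom]; trivial
  simpa only [Set.mem_iUnion, Set.mem_ofPred_eq, exists_prop] using hx

end TopologicalPartialAction

/-! ### Compact-open sets and pointwise formulas -/

theorem exists_isCompact_isOpen_subset {X : Type*} [TopologicalSpace X] [PrespectralSpace X]
    {x : X} {O : Set X} (hO : IsOpen O) (hx : x ∈ O) :
    ∃ V, IsOpen V ∧ IsCompact V ∧ x ∈ V ∧ V ⊆ O := by
  obtain ⟨V, ⟨hVo, hVc⟩, hxV, hVO⟩ :=
    (PrespectralSpace.isTopologicalBasis (X := X)).mem_nhds_iff.1 (hO.mem_nhds hx)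
  exact ⟨V, hVo, hVc, hxV, hVO⟩

section Lc

variable {X : Type*} [TopologicalSpace X] (R : Type*) [CommRing R]

open scoped Classical in
/-- The characteristic function of a compact-open set. -/
noncomputable def charLc [T2Space X] {V : Set X} (ho : IsOpen V) (hc : IsCompact V) : Lc X R :=
  have hV : IsClopen V := ⟨hc.isClosed, ho⟩
  ⟨LocallyConstant.charFn R hV, hc.of_isClosed_subset
    (isClosed_support_of_locallyConstant _) fun x hx => by
      by_contra h
      exact hx (by rw [LocallyConstant.coe_charFn, Set.indicator_of_notMem h])⟩

open scoped Classical in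
theorem charLc_apply [T2Space X] {V : Set X} (ho : IsOpen V) (hc : IsCompact V) (x : X) :
    (charLc R ho hc).1 x = if x ∈ V then 1 else 0 := by
  have hV : IsClopen V := ⟨hc.isClosed, ho⟩
  change LocallyConstant.charFn R hV x = _
  rw [LocallyConstant.coe_charFn, Set.indicator_apply]
  rfl

theorem support_charLc_subset [T2Space X] {V : Set X} (ho : IsOpen V) (hc : IsCompact V) :
    support (charLc R ho hc).1 ⊆ V := by
  classical
  intro x hx
  by_contra h
  exact hx (by rw [charLc_apply, if_neg h])

theorem charLc_self [T2Space X] {V : Set X} (ho : IsOpen V) (hc : IsCompact V) {x : X} (hx : x ∈ V) :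
    (charLc R ho hc).1 x = 1 := by
  classical
  rw [charLc_apply, if_pos hx]

end Lc

namespace TopologicalPartialAction

variable {S : Type*} [InverseSemigroup S] {X : Type*} [TopologicalSpace X]
  (T : TopologicalPartialAction S X) (R : Type*) [CommRing R]

theorem charLc_mem [T2Space X] {V : Set X} (ho : IsOpen V) (hc : IsCompact V) {s : S}
    (h : V ⊆ T.dom s) : charLc R ho hc ∈ T.ideal R s :=
  (T.mem_ideal R).2 ((support_charLc_subset R ho hc).trans h)

variable [T2Space X]

theorem smul_charLc_mem (c : R) {V : Set X} (ho : IsOpen V) (hc : IsCompact V) {s : S}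
    (h : V ⊆ T.dom s) : c • charLc R ho hc ∈ T.ideal R s :=
  (T.mem_ideal R).2 ((support_const_smul_subset c _).trans
    ((support_charLc_subset R ho hc).trans h))

theorem αIso_symm_apply {s : S} (f : T.ideal R s) {x : X} (hx : x ∈ T.dom s⁻¹) :
    ((T.αIso R s).symm f : Lc X R).1 x = (f : Lc X R).1 (T.θ s x) := by
  classical
  obtain ⟨g, rfl⟩ := (T.αIso R s).surjective f
  rw [RingEquiv.symm_apply_apply, αIso_apply, if_pos (T.mapsTo hx), T.θ_inv_apply hx]

/-- Undoing the two applications of `α` turns the product into pointwise convolution. The formula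
needs no case distinction: off `dom s` the factor `a x` vanishes, whatever value `θ s⁻¹` takes
there. -/
theorem coeffMul_apply [PrespectralSpace X] {s t : S} (a : T.ideal R s) (b : T.ideal R t) (x : X) :
    ((T.α R).coeffMul a b : Lc X R).1 x =
      (a : Lc X R).1 x * (b : Lc X R).1 (T.θ s⁻¹ x) := by
  classical
  refine (T.αIso_apply R s ((T.α R).preMul a b) x).trans ?_
  split_ifs with hx
  · change ((T.αIso R s).symm a : Lc X R).1 (T.θ s⁻¹ x) * (b : Lc X R).1 (T.θ s⁻¹ x) = _
    rw [αIso_symm_apply _ _ _ (T.mapsTo_inv hx), T.θ_apply_inv hx]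
  · rw [T.apply_eq_zero R a.2 hx, zero_mul]

end TopologicalPartialAction

/-! ### The skew ring acting on functions -/

namespace TopologicalPartialAction

variable {S : Type*} [InverseSemigroup S] {X : Type*} [TopologicalSpace X]
  (T : TopologicalPartialAction S X) (R : Type*) [CommRing R] [T2Space X] [PrespectralSpace X]

/-- The class of `a δ_s` in the skew inverse semigroup ring. -/
noncomputable def single (s : S) (a : Lc X R) (ha : a ∈ T.ideal R s) : (T.α R).SkewRing :=
  (T.α R).toSkew ((T.α R).δ s ⟨a, ha⟩)

theorem single_eq_of_natLE {r s : S} (h : NatLE r s) {a : Lc X R} (hr : a ∈ T.ideal R r)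
    (hs : a ∈ T.ideal R s) : T.single R r a hr = T.single R s a hs :=
  (T.α R).toSkew_δ_eq_of_natLE h hr hs

theorem single_mul_single {s t : S} {a b c : Lc X R} (ha : a ∈ T.ideal R s) (hb : b ∈ T.ideal R t)
    (h : ∀ x, c.1 x = a.1 x * b.1 (T.θ s⁻¹ x)) :
    ∃ hc : c ∈ T.ideal R (s * t),
      T.single R s a ha * T.single R t b hb = T.single R (s * t) c hc := by
  obtain rfl : ((T.α R).coeffMul (⟨a, ha⟩ : (T.α R).D s) (⟨b, hb⟩ : (T.α R).D t) : Lc X R) = c :=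
    Lc_ext R fun x => by rw [h]; exact T.coeffMul_apply R ⟨a, ha⟩ ⟨b, hb⟩ x
  exact ⟨Subtype.prop _, congrArg (T.α R).toSkew ((T.α R).δ_mul_δ _ _)⟩

/-- In the quotient an index may be raised along the order, so the product can be written over any
convenient `u` above `s * t`, such as `s` itself when `t` is idempotent. -/
theorem single_mul_single_of_natLE {s t u : S} (hu : NatLE (s * t) u) {a b c : Lc X R}
    (ha : a ∈ T.ideal R s) (hb : b ∈ T.ideal R t) (hc : c ∈ T.ideal R u)
    (h : ∀ x, c.1 x = a.1 x * b.1 (T.θ s⁻¹ x)) :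
    T.single R s a ha * T.single R t b hb = T.single R u c hc := by
  obtain ⟨hc', h'⟩ := T.single_mul_single R ha hb h
  rw [h', T.single_eq_of_natLE R hu hc' hc]

theorem τQuot_single {s : S} {a : Lc X R} (ha : a ∈ T.ideal R s) :
    (T.α R).τQuot (T.single R s a ha) = a := by
  rw [single, RingPartialAction.τQuot_toSkew, RingPartialAction.τ_δ]

theorem skewRing_induction {p : (T.α R).SkewRing → Prop} (z : (T.α R).SkewRing) (zero : p 0)
    (single : ∀ s a ha, p (T.single R s a ha)) (add : ∀ x y, p x → p y → p (x + y)) : p z := by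
  obtain ⟨x, rfl⟩ := (T.α R).toSkew_surjective z
  induction x using RingPartialAction.FormalSum.induction with
  | zero => exact zero
  | δ_mem s a => exact single s a a.2
  | add x y hx hy => exact add _ _ hx hy

/-- An additive map out of the skew ring, given on homogeneous elements. -/
noncomputable def liftSkew {B : Type*} [AddCommGroup B] (φ : ∀ s, (T.α R).D s →+ B)
    (h : ∀ r s, NatLE r s → ∀ (a : Lc X R) (hr : a ∈ T.ideal R r) (hs : a ∈ T.ideal R s),
      φ r ⟨a, hr⟩ = φ s ⟨a, hs⟩) : (T.α R).SkewRing →+ B :=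
  AddMonoidHom.mk' (Quotient.lift (fun x => (T.α R).lift φ x) (by
      intro x y hxy
      have h' := (T.α R).map_eq_zero_of_mem_relIdeal ((T.α R).lift φ)
        (fun r s hrs a hr hs => by
          rw [RingPartialAction.lift_δ, RingPartialAction.lift_δ]; exact h r s hrs a hr hs)
        (((T.α R).relIdeal.rel_iff x y).1 hxy)
      rwa [map_sub, sub_eq_zero] at h')) (by
    rintro ⟨x⟩ ⟨y⟩
    exact map_add ((T.α R).lift φ) x y)

theorem liftSkew_single {B : Type*} [AddCommGroup B] (φ : ∀ s, (T.α R).D s →+ B)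
    (h : ∀ r s, NatLE r s → ∀ (a : Lc X R) (hr : a ∈ T.ideal R r) (hs : a ∈ T.ideal R s),
      φ r ⟨a, hr⟩ = φ s ⟨a, hs⟩) {s : S} {a : Lc X R} (ha : a ∈ T.ideal R s) :
    T.liftSkew R φ h (T.single R s a ha) = φ s ⟨a, ha⟩ :=
  (T.α R).lift_δ φ s ⟨a, ha⟩

/-- The representation of the skew ring on functions on `X`:
`(a δ_s) h = a · (h ∘ θ_{s⁻¹})`. -/
noncomputable def rep : (T.α R).SkewRing →+ (X → R) →+ X → R :=
  T.liftSkew R (B := (X → R) →+ X → R)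
    (fun s => AddMonoidHom.mk' (fun a => AddMonoidHom.mk'
      (fun h x => (a : Lc X R).1 x * h (T.θ s⁻¹ x))
      (fun h h' => funext fun x => mul_add _ _ _))
      (fun a b => AddMonoidHom.ext fun h => funext fun x => add_mul _ _ _))
    (by
      intro r s h a hr hs
      refine AddMonoidHom.ext fun f => funext fun x => ?_
      change a.1 x * f (T.θ r⁻¹ x) = a.1 x * f (T.θ s⁻¹ x)
      by_cases hx : x ∈ T.dom r
      · rw [T.θ_inv_restrict h hx]
      · rw [T.apply_eq_zero R hr hx, zero_mul, zero_mul])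

theorem rep_single {s : S} {a : Lc X R} (ha : a ∈ T.ideal R s) (h : X → R) (x : X) :
    T.rep R (T.single R s a ha) h x = a.1 x * h (T.θ s⁻¹ x) := by
  rw [rep, liftSkew_single]; rfl

theorem rep_mul (z w : (T.α R).SkewRing) (h : X → R) :
    T.rep R (z * w) h = T.rep R z (T.rep R w h) := by
  induction z using T.skewRing_induction R with
  | zero => rw [zero_mul, map_zero]; rfl
  | add x y hx hy =>
    rw [add_mul, map_add, map_add, AddMonoidHom.add_apply, AddMonoidHom.add_apply, hx, hy]
  | single s a ha =>
    induction w using T.skewRing_induction R with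
    | zero => rw [mul_zero, map_zero, AddMonoidHom.zero_apply, map_zero]
    | add x y hx hy =>
      rw [mul_add, map_add, map_add, AddMonoidHom.add_apply, AddMonoidHom.add_apply, hx, hy,
        map_add]
    | single t b hb =>
      funext x
      obtain ⟨hc, hm⟩ := T.single_mul_single R (c :=
        ((T.α R).coeffMul (⟨a, ha⟩ : (T.α R).D s) (⟨b, hb⟩ : (T.α R).D t) : Lc X R)) ha hb
        (T.coeffMul_apply R ⟨a, ha⟩ ⟨b, hb⟩)
      rw [hm, rep_single, rep_single, rep_single]
      refine (congrArg (· * _) (T.coeffMul_apply R ⟨a, ha⟩ ⟨b, hb⟩ x)).trans ?_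
      change a.1 x * b.1 (T.θ s⁻¹ x) * _ = _
      rw [mul_assoc]
      -- The composition law for `θ` is available only where both maps are defined; elsewhere one of
      -- the coefficients vanishes and hides the uncontrolled values of `θ`.
      by_cases hx : x ∈ T.dom s
      · by_cases hy : T.θ s⁻¹ x ∈ T.dom t
        · rw [T.θ_inv_mul hx hy]
        · rw [T.apply_eq_zero R hb hy, zero_mul, zero_mul]
      · rw [T.apply_eq_zero R ha hx, zero_mul, zero_mul]

/-! ### Ideals of invariant sets and minimality -/

/-- The ideal of elements acting trivially on the complement of an invariant set. -/
noncomputable def vanishingIdeal {U : Set X} (hU : T.IsInvariant U) :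
    TwoSidedIdeal (T.α R).SkewRing :=
  TwoSidedIdeal.mk' {z | ∀ (h : X → R), ∀ x ∉ U, T.rep R z h x = 0}
    (fun h x _ => by rw [map_zero]; rfl)
    (fun {z w} hz hw h x hx => by
      rw [map_add, AddMonoidHom.add_apply, Pi.add_apply, hz h x hx, hw h x hx, add_zero])
    (fun {z} hz h x hx => by
      rw [map_neg, AddMonoidHom.neg_apply, Pi.neg_apply, hz h x hx, neg_zero])
    -- Only left multiplication uses invariance: at `x ∉ U` the product reads the values of `w` at
    -- `θ s⁻¹ x`, which is again outside `U`.
    (fun {z w} hw h x hx => by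
      induction z using T.skewRing_induction R with
      | zero => rw [zero_mul, map_zero]; rfl
      | add y z hy hz => rw [add_mul, map_add, AddMonoidHom.add_apply, Pi.add_apply, hy, hz, add_zero]
      | single s a ha =>
        rw [rep_mul, rep_single]
        by_cases hxs : x ∈ T.dom s
        · rw [hw _ _ (hU.notMem T hxs hx), mul_zero]
        · rw [T.apply_eq_zero R ha hxs, zero_mul])
    (fun {z w} hz h x hx => by
      rw [rep_mul]; exact hz _ x hx)

theorem mem_vanishingIdeal {U : Set X} (hU : T.IsInvariant U) {z : (T.α R).SkewRing} :
    z ∈ T.vanishingIdeal R hU ↔ ∀ (h : X → R), ∀ x ∉ U, T.rep R z h x = 0 := by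
  rw [vanishingIdeal, TwoSidedIdeal.mem_mk']; rfl

/-- At a point `x ∉ U`, the characteristic function of a compact-open neighbourhood, placed over an
idempotent, sends the constant function `1` to a function with value `1` at `x`. -/
theorem vanishingIdeal_ne_top [Nontrivial R] {U : Set X} (hU : T.IsInvariant U)
    (h : U ≠ Set.univ) : T.vanishingIdeal R hU ≠ ⊤ := by
  intro htop
  obtain ⟨x, hx⟩ := (Set.ne_univ_iff_exists_notMem U).1 h
  obtain ⟨e, -, hxe⟩ := T.exists_idem x
  obtain ⟨V, ho, hc, hxV, hVe⟩ := exists_isCompact_isOpen_subset (T.isOpen_dom e) hxe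
  have hm : T.single R e _ (T.charLc_mem R ho hc hVe) ∈ T.vanishingIdeal R hU := by
    rw [htop]; trivial
  have := (T.mem_vanishingIdeal R hU).1 hm 1 x hx
  rw [rep_single, charLc_self R ho hc hxV, Pi.one_apply, one_mul] at this
  exact one_ne_zero this

/-- The ideal contains the characteristic function of a compact-open subset of `U`, placed over an
idempotent; `τ̃` shows that this element survives in the quotient. -/
theorem vanishingIdeal_ne_bot [Nontrivial R] {U : Set X} (hU : T.IsInvariant U) (ho : IsOpen U)
    (h : U ≠ ∅) : T.vanishingIdeal R hU ≠ ⊥ := by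
  intro hbot
  obtain ⟨x, hx⟩ := Set.nonempty_iff_ne_empty.2 h
  obtain ⟨e, -, hxe⟩ := T.exists_idem x
  obtain ⟨V, hVo, hVc, hxV, hV⟩ :=
    exists_isCompact_isOpen_subset (ho.inter (T.isOpen_dom e)) ⟨hx, hxe⟩
  have hVe := T.charLc_mem R hVo hVc (hV.trans Set.inter_subset_right)
  have hm : T.single R e _ hVe ∈ T.vanishingIdeal R hU := by
    refine (T.mem_vanishingIdeal R hU).2 fun f y hy => ?_
    rw [rep_single]
    have : (charLc R hVo hVc).1 y = 0 := by
      by_contra h0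
      exact hy (hV (support_charLc_subset R hVo hVc h0)).1
    rw [this, zero_mul]
  rw [hbot, TwoSidedIdeal.mem_bot] at hm
  have h0 := T.τQuot_single R hVe
  rw [hm, map_zero] at h0
  have := congrArg (fun f : Lc X R => f.1 x) h0
  simp only [charLc_self R hVo hVc hxV] at this
  exact zero_ne_one this

theorem isMinimal_of_isSimpleRing [Nontrivial R] (h : IsSimpleRing (T.α R).SkewRing) :
    T.IsMinimal := by
  intro U ho hU
  by_contra hne
  rw [not_or] at hne
  rcases h.simple.eq_bot_or_eq_top (T.vanishingIdeal R hU) with hb | ht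
  · exact T.vanishingIdeal_ne_bot R hU ho hne.1 hb
  · exact T.vanishingIdeal_ne_top R hU hne.2 ht

/-- If the skew ring is simple then it acts faithfully on functions on `X`. -/
theorem eq_zero_of_rep_eq_zero [Nontrivial R] [Nonempty X] (h : IsSimpleRing (T.α R).SkewRing)
    {z : (T.α R).SkewRing} (hz : T.rep R z = 0) : z = 0 := by
  have hmem : z ∈ T.vanishingIdeal R T.isInvariant_empty :=
    (T.mem_vanishingIdeal R _).2 fun f x _ => by rw [hz]; rfl
  rcases h.simple.eq_bot_or_eq_top (T.vanishingIdeal R T.isInvariant_empty) with hb | ht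
  · rwa [hb, TwoSidedIdeal.mem_bot] at hmem
  · exact absurd ht (T.vanishingIdeal_ne_top R _ Set.empty_ne_univ)

/-! ### Unit germs and topological principality -/

open scoped Classical in
/-- The sum of the values at `x` of the coefficients whose germ at `x` is a unit. -/
noncomputable def unitGerm (x : X) : (T.α R).SkewRing →+ R :=
  T.liftSkew R
    (fun s => AddMonoidHom.mk' (fun a => if ∃ e, IsIdempotentElem e ∧ NatLE e s ∧ x ∈ T.dom e
      then (a : Lc X R).1 x else 0) (fun a b => by
        split_ifs
        · rfl
        · rw [add_zero]))
    (by
      intro r s hrs a hr hs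
      by_cases hx : x ∈ T.dom r
      · have hiff : (∃ e, IsIdempotentElem e ∧ NatLE e r ∧ x ∈ T.dom e) ↔
            ∃ e, IsIdempotentElem e ∧ NatLE e s ∧ x ∈ T.dom e := by
          constructor
          · rintro ⟨e, he, hle, hxe⟩
            exact ⟨e, he, hle.trans hrs, hxe⟩
          · rintro ⟨e, he, hle, hxe⟩
            -- The witness is idempotent, and because `e * s = e` it equals `e * r`, which lies
            -- below `r`.
            refine ⟨r * r⁻¹ * e, idem_mul (idem_mul_inv r) he, ?_,
              (T.dom_inter_idem (idem_mul_inv r) e (T.dom_le hx)).2 hxe⟩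
            have h1 : e * s = e := by
              have := hle.eq_idem_mul
              rwa [inv_idem he, he.eq] at this
            have h2 : r * r⁻¹ * e = e * r := by
              rw [← h1, ← mul_assoc, idem_comm (idem_mul_inv r) he, mul_assoc, hrs.eq_idem_mul, h1]
            rw [h2]
            exact natLE_idem_mul r he
        simp only [AddMonoidHom.mk'_apply, hiff]
      · have h0 := T.apply_eq_zero R hr hx
        simp [h0])

theorem unitGerm_single_of_exists (x : X) {s : S} {a : Lc X R} (ha : a ∈ T.ideal R s)
    (h : ∃ e, IsIdempotentElem e ∧ NatLE e s ∧ x ∈ T.dom e) :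
    T.unitGerm R x (T.single R s a ha) = a.1 x := by
  rw [unitGerm, liftSkew_single]
  exact if_pos h

theorem unitGerm_single_of_not_exists (x : X) {s : S} {a : Lc X R} (ha : a ∈ T.ideal R s)
    (h : ¬ ∃ e, IsIdempotentElem e ∧ NatLE e s ∧ x ∈ T.dom e) :
    T.unitGerm R x (T.single R s a ha) = 0 := by
  rw [unitGerm, liftSkew_single]
  exact if_neg h

/-- In a simple skew ring, an element fixing an open set pointwise has a unit germ somewhere. -/
theorem exists_idem_of_fixes_open [Nontrivial R] [Nonempty X]
    (h : IsSimpleRing (T.α R).SkewRing) {s : S} {O : Set X} (hO : IsOpen O)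
    (hOs : O ⊆ T.dom s⁻¹) (hfix : ∀ x ∈ O, T.θ s x = x) {x : X} (hx : x ∈ O) :
    ∃ e, IsIdempotentElem e ∧ NatLE e s ∧ x ∈ T.dom e := by
  by_contra hne
  obtain ⟨V, ho, hc, hxV, hV⟩ := exists_isCompact_isOpen_subset hO hx
  have he := idem_inv_mul s
  have h1 := T.charLc_mem R ho hc (s := s)
    fun y hy => by rw [← hfix y (hV hy)]; exact T.mapsTo (hOs (hV hy))
  have h2 := T.charLc_mem R ho hc (s := s⁻¹ * s) fun y hy => T.dom_inv_mul (hOs (hV hy))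
  -- On `V` both `s` and `s⁻¹ * s` act as the identity, so `rep` cannot tell the two terms apart,
  -- whereas `unitGerm` at `x` counts only the second.
  have hz : T.single R s _ h1 - T.single R (s⁻¹ * s) _ h2 = 0 := by
    refine T.eq_zero_of_rep_eq_zero R h (AddMonoidHom.ext fun f => funext fun y => ?_)
    rw [map_sub, AddMonoidHom.sub_apply, Pi.sub_apply, rep_single, rep_single]
    change _ = (0 : R)
    by_cases hy : y ∈ V
    · have e1 : T.θ s⁻¹ y = y := by
        have := T.θ_inv_apply (hOs (hV hy))
        rwa [hfix y (hV hy)] at this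
      have e2 : T.θ (s⁻¹ * s)⁻¹ y = y := by
        rw [inv_idem he]
        exact T.θ_idem he (T.dom_inv_mul (hOs (hV hy)))
      rw [e1, e2, sub_self]
    · have : (charLc R ho hc).1 y = 0 := by
        by_contra h0
        exact hy (support_charLc_subset R ho hc h0)
      rw [this, zero_mul, zero_mul, sub_self]
  have h0 := congrArg (T.unitGerm R x) hz
  rw [map_sub, map_zero, T.unitGerm_single_of_not_exists R x h1 hne,
    T.unitGerm_single_of_exists R x h2
      ⟨_, he, NatLE.refl _, T.dom_inv_mul (hOs hx)⟩, charLc_self R ho hc hxV, zero_sub] at h0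
  exact neg_ne_zero.2 one_ne_zero h0

/-- A point fails to be principal exactly when it lies in some `B s`, the set of fixed points of `s`
whose germ is not a unit. Each `B s` is nowhere dense and there are countably many of them, so the
Baire property applies. -/
theorem isTopologicallyPrincipal_of_isSimpleRing [Countable S] [Nontrivial R] [Nonempty X]
    [BaireSpace X] (h : IsSimpleRing (T.α R).SkewRing) : T.IsTopologicallyPrincipal := by
  let B : S → Set X := fun s => {x | x ∈ T.dom s⁻¹ ∧ T.θ s x = x ∧
    ¬ ∃ e, IsIdempotentElem e ∧ NatLE e s ∧ x ∈ T.dom e}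
  have hB : ∀ s, IsNowhereDense (B s) := by
    intro s
    rw [IsNowhereDense, Set.eq_empty_iff_forall_notMem]
    intro x hx
    have hd := T.isOpen_dom s⁻¹
    -- `B s` is relatively closed in `dom s⁻¹`: being moved by `s` is an open condition because `X`
    -- is Hausdorff, and having a unit germ is open because each `dom e` is.
    have hcl : closure (B s) ∩ T.dom s⁻¹ ⊆ B s := by
      rintro y ⟨hy, hys⟩
      refine ⟨hys, ?_, ?_⟩
      · by_contra hne
        have hcont : ContinuousAt (T.θ s) y := (T.θ s).continuousAt (by rwa [T.source_eq])
        have hev := (hcont.ne_iff_eventually_ne continuousAt_id).1 hne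
        obtain ⟨z, hz, hzB⟩ := (mem_closure_iff_frequently.1 hy).and_eventually hev |>.exists
        exact hzB hz.2.1
      · rintro ⟨e, he, hle, hye⟩
        obtain ⟨z, hz, hze⟩ := (mem_closure_iff_frequently.1 hy).and_eventually
          ((T.isOpen_dom e).mem_nhds hye) |>.exists
        exact hz.2.2 ⟨e, he, hle, hze⟩
    -- If the closure had interior, that interior would meet `B s` at some `y`, and its part in `dom
    -- s⁻¹` would be an open set around `y` fixed pointwise by `s`; the germ at `y` would then be a
    -- unit.
    obtain ⟨y, hyi, hyB⟩ := mem_closure_iff.1 (interior_subset hx) _ isOpen_interior hx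
    have hsub : interior (closure (B s)) ∩ T.dom s⁻¹ ⊆ B s := fun z hz =>
      hcl ⟨interior_subset hz.1, hz.2⟩
    exact hyB.2.2 (T.exists_idem_of_fixes_open R h (isOpen_interior.inter hd)
      Set.inter_subset_right (fun z hz => (hsub hz).2.1) ⟨hyi, hyB.1⟩)
  have hdense : Dense (⋂ s, (closure (B s))ᶜ) := by
    refine dense_iInter_of_isOpen (fun s => isClosed_closure.isOpen_compl) fun s => ?_
    rw [← interior_eq_empty_iff_dense_compl]
    exact hB s
  refine hdense.mono fun x hx s hxs hfix => ?_
  by_contra hne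
  exact Set.mem_iInter.1 hx s (subset_closure ⟨hxs, hfix, hne⟩)

end TopologicalPartialAction

/-- The pointwise inverse (with `0⁻¹ = 0`) of a function in `L_c(X)`. -/
def invLc {X : Type*} [TopologicalSpace X] {R : Type*} [Field R] (a : Lc X R) : Lc X R :=
  ⟨a.1.map fun c => c⁻¹, a.2.of_isClosed_subset (isClosed_support_of_locallyConstant _)
    fun _ hx h0 => hx (inv_eq_zero.2 h0)⟩

/-! ### Isolating one germ at a point with trivial isotropy -/

namespace TopologicalPartialAction

variable {S : Type*} [InverseSemigroup S] {X : Type*} [TopologicalSpace X]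
  (T : TopologicalPartialAction S X) [T2Space X] [PrespectralSpace X]

section CommRing

variable (R : Type*) [CommRing R]

theorem single_zero (s : S) (h : (0 : Lc X R) ∈ T.ideal R s) : T.single R s 0 h = 0 :=
  congrArg (T.α R).toSkew (map_zero ((T.α R).δ s))

theorem single_add {s : S} {a b : Lc X R} (ha : a ∈ T.ideal R s) (hb : b ∈ T.ideal R s)
    (hab : a + b ∈ T.ideal R s) :
    T.single R s (a + b) hab = T.single R s a ha + T.single R s b hb :=
  congrArg (T.α R).toSkew
    (map_add ((T.α R).δ s) (⟨a, ha⟩ : (T.α R).D s) (⟨b, hb⟩ : (T.α R).D s))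

theorem single_idem_mul_single {e s : S} (he : IsIdempotentElem e) {f a : Lc X R}
    (hf : f ∈ T.ideal R e) (ha : a ∈ T.ideal R s) :
    T.single R e f hf * T.single R s a ha =
      T.single R s (f * a) ((T.ideal R s).mul_mem_left _ _ ha) := by
  refine T.single_mul_single_of_natLE R (natLE_idem_mul s he) hf ha _ fun x => ?_
  change f.1 x * a.1 x = _
  by_cases hx : x ∈ T.dom e
  · rw [inv_idem he, T.θ_idem he hx]
  · rw [T.apply_eq_zero R hf hx, zero_mul, zero_mul]

/-- The sums over the germs at `x`, grouped by their sources, of the values of the coefficients. -/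
noncomputable def fiberSum (x : X) : (T.α R).SkewRing →+ (X →₀ R) :=
  T.liftSkew R (fun s => AddMonoidHom.mk'
      (fun a => Finsupp.single (T.θ s⁻¹ x) ((a : Lc X R).1 x))
      (fun _ _ => Finsupp.single_add _ _ _))
    (by
      intro r s h a hr hs
      change Finsupp.single (T.θ r⁻¹ x) (a.1 x) = Finsupp.single (T.θ s⁻¹ x) (a.1 x)
      by_cases hx : x ∈ T.dom r
      · rw [T.θ_inv_restrict h hx]
      · rw [T.apply_eq_zero R hr hx, Finsupp.single_zero, Finsupp.single_zero])

theorem fiberSum_single (x : X) {s : S} {a : Lc X R} (ha : a ∈ T.ideal R s) :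
    T.fiberSum R x (T.single R s a ha) = Finsupp.single (T.θ s⁻¹ x) (a.1 x) := by
  rw [fiberSum, liftSkew_single]; rfl

/-- `τ̃` adds up all coefficients at `x` regardless of source, so `fiberSum` refines it: where `τ̃
z` is non-zero, some source carries a non-zero sum. -/
theorem sum_fiberSum (x : X) (z : (T.α R).SkewRing) :
    (T.fiberSum R x z).sum (fun _ c => c) = ((T.α R).τQuot z).1 x := by
  induction z using T.skewRing_induction R with
  | zero => rw [map_zero, map_zero, Finsupp.sum_zero_index]; rfl
  | add y z hy hz =>
    rw [map_add, map_add, Finsupp.sum_add_index' (fun _ => rfl) (fun _ _ _ => rfl), hy, hz]; rfl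
  | single s a ha => rw [fiberSum_single, τQuot_single, Finsupp.sum_single_index rfl]

theorem exists_of_fiberSum_ne_zero {x y : X} {z : (T.α R).SkewRing}
    (h : T.fiberSum R x z y ≠ 0) : ∃ s, x ∈ T.dom s ∧ T.θ s⁻¹ x = y := by
  by_contra! hne
  apply h
  induction z using T.skewRing_induction R with
  | zero => rw [map_zero]; rfl
  | add u v hu hv =>
    rw [map_add, Finsupp.add_apply]
    by_cases hu0 : T.fiberSum R x u y = 0
    · by_cases hv0 : T.fiberSum R x v y = 0
      · rw [hu0, hv0, add_zero]
      · exact absurd (hv hv0) hv0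
    · exact absurd (hu hu0) hu0
  | single s a ha =>
    rw [fiberSum_single]
    by_cases hx : x ∈ T.dom s
    · exact Finsupp.single_eq_of_ne (hne s hx).symm
    · rw [T.apply_eq_zero R ha hx, Finsupp.single_zero]; rfl

open Topology in
/-- Cutting an element down to small neighbourhoods of the range and the source of a germ at a
point with trivial isotropy leaves a multiple of the bisection through that germ. -/
theorem exists_nhds_single_mul_mul_single {x : X} (hx : x ∈ T.principalSet) {s e e' : S}
    (he : IsIdempotentElem e) (he' : IsIdempotentElem e') (hxs : x ∈ T.dom s)
    (z : (T.α R).SkewRing) :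
    ∃ V₀ ∈ 𝓝 x, ∃ W₀ ∈ 𝓝 (T.θ s⁻¹ x), ∀ (V W : Set X) (hVo : IsOpen V) (hVc : IsCompact V)
      (hWo : IsOpen W) (hWc : IsCompact W) (hVe : V ⊆ T.dom e) (hWe : W ⊆ T.dom e')
      (hVs : V ⊆ T.dom s),
      V ⊆ V₀ → W ⊆ W₀ → (∀ v ∈ V, T.θ s⁻¹ v ∈ W) →
      T.single R e _ (T.charLc_mem R hVo hVc hVe) * z *
        T.single R e' _ (T.charLc_mem R hWo hWc hWe) =
          T.single R s _ (T.smul_charLc_mem R (T.fiberSum R x z (T.θ s⁻¹ x)) hVo hVc hVs) := by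
  induction z using T.skewRing_induction R with
  | zero =>
    refine ⟨Set.univ, Filter.univ_mem, Set.univ, Filter.univ_mem, ?_⟩
    intro V W hVo hVc hWo hWc hVe hWe hVs _ _ _
    have h0 : T.fiberSum R x 0 (T.θ s⁻¹ x) • charLc R hVo hVc = 0 := by
      rw [map_zero, Finsupp.zero_apply, zero_smul]
    rw [mul_zero, zero_mul]
    simp only [h0, single_zero]
  | add z w hz hw =>
    obtain ⟨V₁, hV₁, W₁, hW₁, h₁⟩ := hz
    obtain ⟨V₂, hV₂, W₂, hW₂, h₂⟩ := hw
    refine ⟨_, Filter.inter_mem hV₁ hV₂, _, Filter.inter_mem hW₁ hW₂, ?_⟩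
    intro V W hVo hVc hWo hWc hVe hWe hVs hV hW hθ
    have hadd : T.fiberSum R x (z + w) (T.θ s⁻¹ x) • charLc R hVo hVc =
        T.fiberSum R x z (T.θ s⁻¹ x) • charLc R hVo hVc +
          T.fiberSum R x w (T.θ s⁻¹ x) • charLc R hVo hVc := by
      rw [map_add, Finsupp.add_apply, add_smul]
    rw [mul_add, add_mul, h₁ V W hVo hVc hWo hWc hVe hWe hVs (hV.trans Set.inter_subset_left)
      (hW.trans Set.inter_subset_left) hθ, h₂ V W hVo hVc hWo hWc hVe hWe hVs
      (hV.trans Set.inter_subset_right) (hW.trans Set.inter_subset_right) hθ]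
    simp only [hadd]
    exact (T.single_add R _ _ _).symm
  | single t a ha =>
    classical
    rw [fiberSum_single]
    have hmul : ∀ (V : Set X) (hVo : IsOpen V) (hVc : IsCompact V) (z : X),
        (charLc R hVo hVc * a).1 z = if z ∈ V then a.1 z else 0 := by
      intro V hVo hVc z
      change (charLc R hVo hVc).1 z * a.1 z = _
      rw [charLc_apply]
      split_ifs
      · rw [one_mul]
      · rw [zero_mul]
    have hsmul : ∀ (c : R) (V : Set X) (hVo : IsOpen V) (hVc : IsCompact V) (z : X),
        (c • charLc R hVo hVc).1 z = if z ∈ V then c else 0 := by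
      intro c V hVo hVc z
      change c * (charLc R hVo hVc).1 z = _
      rw [charLc_apply]
      split_ifs
      · rw [mul_one]
      · rw [mul_zero]
    have hconst : {z | a.1 z = a.1 x} ∈ 𝓝 x :=
      (IsLocallyConstant.iff_eventually_eq _).1 a.1.isLocallyConstant x
    by_cases hxt : x ∈ T.dom t
    · by_cases hst : T.θ s⁻¹ x = T.θ t⁻¹ x
      -- Same source: trivial isotropy provides a common restriction `r` of `s` and `t` at `x`. For
      -- `V` inside `dom r` the index `t` can be lowered to `r` and raised to `s`, and for `V` small
      -- the coefficient is constant.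
      · obtain ⟨r, hrs, hrt, hxr⟩ := T.exists_natLE_of_mem_principalSet hx hxs hxt hst
        refine ⟨_, Filter.inter_mem hconst ((T.isOpen_dom r).mem_nhds hxr), Set.univ,
          Filter.univ_mem, ?_⟩
        intro V W hVo hVc hWo hWc hVe hWe hVs hV _ hθ
        have hr : charLc R hVo hVc * a ∈ T.ideal R r := (T.mem_ideal R).2
          ((support_mul_subset_left _ _).trans ((support_charLc_subset R hVo hVc).trans
            (hV.trans Set.inter_subset_right)))
        have hs : charLc R hVo hVc * a ∈ T.ideal R s := (T.mem_ideal R).2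
          ((support_mul_subset_left _ _).trans ((support_charLc_subset R hVo hVc).trans hVs))
        rw [T.single_idem_mul_single R he, ← T.single_eq_of_natLE R hrt hr,
          T.single_eq_of_natLE R hrs hr hs]
        refine T.single_mul_single_of_natLE R (natLE_mul_idem s he') _ _ _ fun z => ?_
        rw [hsmul, hmul, hst, Finsupp.single_eq_same]
        split_ifs with hz
        · rw [charLc_self R hWo hWc (hθ z hz), mul_one]
          exact (hV hz).1.symm
        · rw [zero_mul]
      -- Different sources: disjoint neighbourhoods of the two sources and continuity of `θ t⁻¹`
      -- make `θ t⁻¹` carry `V` off `W`, so the right factor kills the term.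
      · obtain ⟨W₀, W₁, hW₀, hW₁, hy, hy', hd⟩ := t2_separation hst
        have hcont : ContinuousAt (T.θ t⁻¹) x :=
          (T.θ t⁻¹).continuousAt (by rwa [T.source_eq, invInv])
        refine ⟨_, hcont (hW₁.mem_nhds hy'), W₀, hW₀.mem_nhds hy, ?_⟩
        intro V W hVo hVc hWo hWc hVe hWe hVs hV hW hθ
        rw [T.single_idem_mul_single R he]
        have h1 := T.single_mul_single_of_natLE R (natLE_mul_idem t he')
          ((T.ideal R t).mul_mem_left (charLc R hVo hVc) _ ha) (T.charLc_mem R hWo hWc hWe)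
          (T.ideal R t).zero_mem fun z => by
            rw [hmul]
            split_ifs with hz
            · rw [charLc_apply, if_neg, mul_zero]
              · rfl
              · exact fun hzW => hd.notMem_of_mem_left (hW hzW) (hV hz)
            · rw [zero_mul]; rfl
        rw [h1, single_zero]
        simp only [Finsupp.single_eq_of_ne hst, zero_smul, single_zero]
    -- If `x ∉ dom t`, the locally constant `a` vanishes at `x`, hence near `x`, and the left factor
    -- kills the term.
    · refine ⟨_, hconst, Set.univ, Filter.univ_mem, ?_⟩
      intro V W hVo hVc hWo hWc hVe hWe hVs hV _ hθ
      have h0 := T.apply_eq_zero R ha hxt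
      have h1 : charLc R hVo hVc * a = 0 := Lc_ext R fun z => by
        rw [hmul]
        split_ifs with hz
        · exact (hV hz).trans h0
        · rfl
      rw [T.single_idem_mul_single R he]
      simp only [h0, h1, single_zero, zero_mul, Finsupp.single_zero, Finsupp.zero_apply, zero_smul]

theorem exists_τQuot_apply_ne_zero [Nontrivial R] (x : X) :
    ∃ z : (T.α R).SkewRing, ((T.α R).τQuot z).1 x ≠ 0 := by
  obtain ⟨e, -, hxe⟩ := T.exists_idem x
  obtain ⟨V, ho, hc, hxV, hVe⟩ := exists_isCompact_isOpen_subset (T.isOpen_dom e) hxe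
  refine ⟨T.single R e _ (T.charLc_mem R ho hc hVe), ?_⟩
  rw [τQuot_single, charLc_self R ho hc hxV]
  exact one_ne_zero

end CommRing

/-! ### Ideals over a field -/

section Field

variable (R : Type*) [Field R]

/-- Over a field, `a` is invertible on its support, so `(a δ_s)(b δ_{s⁻¹t}) = g δ_t` can be solved
with `b = α_s⁻¹(g / a)`; the index `s s⁻¹ t` is raised to `t`. Thus membership of a homogeneous
element in `I` transfers to all smaller supports and to every admissible index. -/
theorem single_mem_of_support_subset {I : TwoSidedIdeal (T.α R).SkewRing} {s t : S}
    {a g : Lc X R} {ha : a ∈ T.ideal R s} (hI : T.single R s a ha ∈ I)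
    (hga : support g.1 ⊆ support a.1) (hg : g ∈ T.ideal R t) : T.single R t g hg ∈ I := by
  have hb : g * invLc a ∈ T.ideal R s := (T.mem_ideal R).2
    (((support_mul_subset_left _ _).trans hga).trans ((T.mem_ideal R).1 ha))
  have hb_apply : ∀ x, (g * invLc a).1 x = g.1 x * (a.1 x)⁻¹ := fun x => rfl
  obtain ⟨b, hbdef⟩ : ∃ b, b = (T.αIso R s).symm ⟨_, hb⟩ := ⟨_, rfl⟩
  have happly : ∀ x ∈ T.dom s⁻¹, (b : Lc X R).1 x = g.1 (T.θ s x) * (a.1 (T.θ s x))⁻¹ := by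
    intro x hx
    rw [hbdef, αIso_symm_apply _ _ _ hx, hb_apply]
  have hbt : (b : Lc X R) ∈ T.ideal R (s⁻¹ * t) := by
    refine (T.mem_ideal R).2 fun x hx => ?_
    have hxs : x ∈ T.dom s⁻¹ := (T.mem_ideal R).1 b.2 hx
    rw [mem_support, happly x hxs] at hx
    exact T.dom_mul hxs (by
      rw [invInv]; exact (T.mem_ideal R).1 hg (left_ne_zero_of_mul hx))
  have hle : NatLE (s * (s⁻¹ * t)) t := by
    rw [← mul_assoc]; exact natLE_idem_mul t (idem_mul_inv s)
  rw [← T.single_mul_single_of_natLE R hle ha hbt hg fun x => ?_]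
  · exact I.mul_mem_right _ _ hI
  · by_cases hx : a.1 x = 0
    · rw [hx, zero_mul]
      by_contra h
      exact hga h hx
    · have hxs : x ∈ T.dom s := (T.mem_ideal R).1 ha hx
      rw [happly _ (T.mapsTo_inv hxs), T.θ_apply_inv hxs]
      field_simp

/-- In the presence of enough points with trivial isotropy, an ideal containing an element on which
`τ̃` does not vanish contains a non-zero homogeneous element. -/
theorem exists_single_mem (h : T.IsTopologicallyPrincipal) {I : TwoSidedIdeal (T.α R).SkewRing}
    {f : (T.α R).SkewRing} (hf : f ∈ I) (hne : (support ((T.α R).τQuot f).1).Nonempty) :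
    ∃ (s : S) (a : Lc X R) (ha : a ∈ T.ideal R s),
      T.single R s a ha ∈ I ∧ (support a.1).Nonempty := by
  have hopen : IsOpen (support ((T.α R).τQuot f).1) :=
    ((T.α R).τQuot f).1.isLocallyConstant {0}ᶜ
  obtain ⟨x, hxf, hx⟩ := h.inter_open_nonempty _ hopen hne
  obtain ⟨y, hy⟩ : ∃ y, T.fiberSum R x f y ≠ 0 := by
    by_contra! h0
    have : T.fiberSum R x f = 0 := Finsupp.ext h0
    have hs := T.sum_fiberSum R x f
    rw [this, Finsupp.sum_zero_index] at hs
    exact hxf hs.symm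
  obtain ⟨s, hxs, rfl⟩ := T.exists_of_fiberSum_ne_zero R hy
  obtain ⟨e, he, hxe⟩ := T.exists_idem x
  obtain ⟨e', he', hye⟩ := T.exists_idem (T.θ s⁻¹ x)
  obtain ⟨V₀, hV₀, W₀, hW₀, hloc⟩ :=
    T.exists_nhds_single_mul_mul_single R hx he he' hxs f
  obtain ⟨W, hWo, hWc, hyW, hW⟩ := exists_isCompact_isOpen_subset
    (isOpen_interior.inter (T.isOpen_dom e')) ⟨mem_interior_iff_mem_nhds.2 hW₀, hye⟩
  have hcont : ContinuousAt (T.θ s⁻¹) x :=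
    (T.θ s⁻¹).continuousAt (by rwa [T.source_eq, invInv])
  -- `W` is fixed before `V`, so that `V` can be shrunk until `θ s⁻¹` maps it into `W`.
  have hN : V₀ ∩ (T.dom e ∩ (T.dom s ∩ T.θ s⁻¹ ⁻¹' W)) ∈ nhds x :=
    Filter.inter_mem hV₀ (Filter.inter_mem ((T.isOpen_dom e).mem_nhds hxe)
      (Filter.inter_mem ((T.isOpen_dom s).mem_nhds hxs) (hcont (hWo.mem_nhds hyW))))
  obtain ⟨V, hVo, hVc, hxV, hV⟩ :=
    exists_isCompact_isOpen_subset isOpen_interior (mem_interior_iff_mem_nhds.2 hN)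
  replace hV := hV.trans interior_subset
  obtain ⟨c, hc⟩ : ∃ c, c = T.fiberSum R x f (T.θ s⁻¹ x) := ⟨_, rfl⟩
  refine ⟨s, c • charLc R hVo hVc, T.smul_charLc_mem R c hVo hVc fun v hv => (hV hv).2.2.1, ?_,
    x, ?_⟩
  · subst hc
    rw [← hloc V W hVo hVc hWo hWc (fun v hv => (hV hv).2.1) (fun w hw => (hW hw).2)
      (fun v hv => (hV hv).2.2.1) (fun v hv => (hV hv).1) (fun w hw => interior_subset (hW hw).1)
      (fun v hv => (hV hv).2.2.2)]
    exact I.mul_mem_right _ _ (I.mul_mem_left _ _ hf)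
  · change c * (charLc R hVo hVc).1 x ≠ 0
    rw [charLc_self R hVo hVc hxV, mul_one, hc]
    exact hy

/-- The points lying in the support of some homogeneous element of `I` form an open invariant set,
which minimality makes all of `X`. A compact support is then covered by finitely many such supports,
and functions can be cut along them. -/
theorem eq_top_of_single_mem (h : T.IsMinimal) {I : TwoSidedIdeal (T.α R).SkewRing} {s : S}
    {a : Lc X R} {ha : a ∈ T.ideal R s} (hI : T.single R s a ha ∈ I)
    (hne : (support a.1).Nonempty) : I = ⊤ := by
  obtain ⟨U, hU⟩ : ∃ U : Set X, U = {x | ∃ (s : S) (a : Lc X R) (ha : a ∈ T.ideal R s),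
    T.single R s a ha ∈ I ∧ x ∈ support a.1} := ⟨_, rfl⟩
  have hopen : ∀ a : Lc X R, IsOpen (support a.1) := fun a =>
    a.1.isLocallyConstant {0}ᶜ
  have hUo : IsOpen U := by
    rw [hU, isOpen_iff_mem_nhds]
    rintro x ⟨s, a, ha, hI, hx⟩
    filter_upwards [(hopen a).mem_nhds hx] with y hy
    exact ⟨s, a, ha, hI, hy⟩
  have hUi : T.IsInvariant U := by
    rintro t _ ⟨x, ⟨hxU, hxt⟩, rfl⟩
    rw [hU] at hxU ⊢
    obtain ⟨s, a, ha, hI, hx⟩ := hxU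
    obtain ⟨V, hVo, hVc, hxV, hV⟩ :=
      exists_isCompact_isOpen_subset ((hopen a).inter (T.isOpen_dom t⁻¹)) ⟨hx, hxt⟩
    have hVt := T.charLc_mem R hVo hVc (hV.trans Set.inter_subset_right)
    have h1 := T.single_mem_of_support_subset R hI
      ((support_charLc_subset R hVo hVc).trans (hV.trans Set.inter_subset_left)) hVt
    -- Support is moved from `x` to `θ t x` by multiplying `1_V δ_{t⁻¹} ∈ I` on the left by
    -- `α_t(1_V) δ_t`; the resulting coefficient at `θ t x` is `1`.
    obtain ⟨b, hb⟩ : ∃ b, b = T.αIso R t ⟨_, hVt⟩ := ⟨_, rfl⟩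
    obtain ⟨hc, hm⟩ := T.single_mul_single R (c :=
        ((T.α R).coeffMul (b : (T.α R).D t) (⟨_, hVt⟩ : (T.α R).D t⁻¹) : Lc X R)) b.2 hVt
        (T.coeffMul_apply R b ⟨_, hVt⟩)
    refine ⟨_, _, hc, ?_, ?_⟩
    · rw [← hm]; exact I.mul_mem_left _ _ h1
    · classical
      rw [mem_support]
      refine ne_of_eq_of_ne (T.coeffMul_apply R b ⟨_, hVt⟩ _) ?_
      rw [hb, αIso_apply, if_pos (T.mapsTo hxt), T.θ_inv_apply hxt]
      change (charLc R hVo hVc).1 x * (charLc R hVo hVc).1 x ≠ 0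
      rw [charLc_self R hVo hVc hxV, one_mul]
      exact one_ne_zero
  have hUtop : U = Set.univ := by
    refine (h U hUo hUi).resolve_left fun h0 => ?_
    obtain ⟨x, hx⟩ := hne
    have : x ∈ U := by rw [hU]; exact ⟨s, a, ha, hI, hx⟩
    rw [h0] at this
    exact this
  -- The property passes to unions because `N` is clopen: a function supported in `N ∪ M` splits
  -- into its restrictions to `N` and to the complement of `N`.
  have key : ∀ K : Set X, IsCompact K → ∃ N : Set X, IsClopen N ∧ K ⊆ N ∧
      ∀ (g : Lc X R) (t : S) (hg : g ∈ T.ideal R t), support g.1 ⊆ N →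
        T.single R t g hg ∈ I := by
    intro K hK
    refine hK.induction_on (p := fun K => ∃ N : Set X, IsClopen N ∧ K ⊆ N ∧
      ∀ (g : Lc X R) (t : S) (hg : g ∈ T.ideal R t), support g.1 ⊆ N →
        T.single R t g hg ∈ I) ?_ ?_ ?_ ?_
    · refine ⟨∅, isClopen_empty, subset_rfl, fun g t hg hgN => ?_⟩
      obtain rfl : g = 0 := Lc_ext R fun x => by
        by_contra hx
        exact hgN hx
      rw [single_zero]
      exact I.zero_mem
    · rintro K L hKL ⟨N, hN, hLN, hNI⟩
      exact ⟨N, hN, hKL.trans hLN, hNI⟩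
    · rintro K L ⟨N, hN, hKN, hNI⟩ ⟨M, hM, hLM, hMI⟩
      refine ⟨N ∪ M, hN.union hM, Set.union_subset_union hKN hLM, fun g t hg hgNM => ?_⟩
      classical
      have hsub : ∀ {V : Set X} (hV : IsClopen V), support (cut R hV g).1 ⊆ support g.1 :=
        fun hV x hx h0 => hx (by rw [cut_apply, h0, ite_self])
      have hcut : ∀ {V : Set X} (hV : IsClopen V), cut R hV g ∈ T.ideal R t :=
        fun hV => (T.mem_ideal R).2 ((hsub hV).trans ((T.mem_ideal R).1 hg))
      have hdecomp : g = cut R hN g + cut R hN.compl g := Lc_ext R fun x => by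
        change _ = (cut R hN g).1 x + (cut R hN.compl g).1 x
        rw [cut_apply, cut_apply]
        by_cases hx : x ∈ N
        · simp [hx]
        · simp [hx]
      have hsum : T.single R t g hg =
          T.single R t _ (hcut hN) + T.single R t _ (hcut hN.compl) := by
        rw [← T.single_add R _ _ (hdecomp ▸ hg)]
        congr 1
      rw [hsum]
      refine I.add_mem (hNI _ t _ fun x hx => ?_) (hMI _ t _ fun x hx => ?_)
      · by_contra hxN
        exact hx (by rw [cut_apply, if_neg hxN])
      · refine (hgNM (hsub _ hx)).resolve_left fun hxN => ?_
        exact hx (by rw [cut_apply, if_neg fun hx' : x ∈ Nᶜ => hx' hxN])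
    · intro x _
      have hx : x ∈ U := by rw [hUtop]; trivial
      rw [hU] at hx
      obtain ⟨s, a, ha, hI, hx⟩ := hx
      exact ⟨support a.1, mem_nhdsWithin_of_mem_nhds ((hopen a).mem_nhds hx), support a.1,
        ⟨isClosed_support_of_locallyConstant _, hopen a⟩, subset_rfl,
        fun g t hg hga => T.single_mem_of_support_subset R hI hga hg⟩
  rw [eq_top_iff]
  intro z _
  induction z using T.skewRing_induction R with
  | zero => exact I.zero_mem
  | add y z hy hz => exact I.add_mem (hy trivial) (hz trivial)
  | single t g hg =>
    obtain ⟨N, -, hgN, hN⟩ := key _ g.2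
    exact hN g t hg hgN

end Field

end TopologicalPartialAction

/-- For a topological partial action `T` of a countable inverse semigroup on a non-empty, second
countable, zero-dimensional, locally compact Hausdorff space `X` and a field `R`, the ring
`L_c(X) ⋊ S` is simple iff the action is minimal, topologically principal, and every non-zero ideal
contains an element whose image under `τ̃` has non-empty support. Zero-dimensionality (a basis of
compact-open sets) is `PrespectralSpace`. -/
theorem corollary4p13 {S : Type*} [InverseSemigroup S] [Countable S]
    {X : Type*} [TopologicalSpace X] [Nonempty X] [T2Space X] [LocallyCompactSpace X]
    [PrespectralSpace X] [SecondCountableTopology X]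
    {R : Type*} [Field R] (T : TopologicalPartialAction S X) :
    IsSimpleRing (T.α R).SkewRing ↔
      T.IsMinimal ∧ T.IsTopologicallyPrincipal ∧
        ∀ I : TwoSidedIdeal (T.α R).SkewRing, I ≠ ⊥ →
          ∃ f ∈ I, (support ((T.α R).τQuot f).1).Nonempty := by
  constructor
  · intro h
    refine ⟨T.isMinimal_of_isSimpleRing R h, T.isTopologicallyPrincipal_of_isSimpleRing R h, ?_⟩
    intro I hI
    -- By simplicity `I` is everything, so any element with non-zero image under `τ̃` will do.
    obtain rfl := (h.simple.eq_bot_or_eq_top I).resolve_left hI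
    obtain ⟨x⟩ := ‹Nonempty X›
    obtain ⟨z, hz⟩ := T.exists_τQuot_apply_ne_zero R x
    exact ⟨z, trivial, x, hz⟩
  · rintro ⟨hmin, htop, hτ⟩
    obtain ⟨x⟩ := ‹Nonempty X›
    obtain ⟨z, hz⟩ := T.exists_τQuot_apply_ne_zero R x
    have hnt : Nontrivial (TwoSidedIdeal (T.α R).SkewRing) := by
      refine ⟨⊥, ⊤, fun hbt => hz ?_⟩
      have h0 : z ∈ (⊥ : TwoSidedIdeal (T.α R).SkewRing) := by rw [hbt]; trivial
      rw [TwoSidedIdeal.mem_bot] at h0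
      rw [h0, map_zero]
      rfl
    refine ⟨⟨fun I => ?_⟩⟩
    by_cases hI : I = ⊥
    · exact Or.inl hI
    · obtain ⟨f, hf, hne⟩ := hτ I hI
      obtain ⟨s, a, ha, haI, hane⟩ := T.exists_single_mem R htop hf hne
      exact Or.inr (T.eq_top_of_single_mem R hmin haI hane)
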